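/- For integers $n, r \ge 0$, the Kneser graph $KG(n,r)$ is the graph whose vertices are the $r$-element subsets of $\{1,\dots,n\}$, two distinct vertices being adjacent if and only if they are disjoint as sets. The girth of a graph is the length of its shortest cycle, and is $\infty$ if the graph has no cycle. The Erdős–Hajnal conjecture holds for Kneser graphs, that is: for all integers $k, g \ge 0$ there exists an integer $h(k,g)$ such that every Kneser graph $KG(n,r)$ with chromatic number $\chi(KG(n,r)) \ge h(k,g)$ contains a subgraph $H$ with chromatic number $\chi(H) \ge k$ and girth greater than $g$. -/

import Mathlib

/-- The Kneser graph `KG(n, r)`: its vertices are the `r`-element subsets of an `n`-element set,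
and two distinct vertices are adjacent if they are disjoint as sets. (Distinctness follows from
disjointness unless `r = 0`, where it excludes a loop at the only vertex `∅`.) -/
def kneserGraph (n r : ℕ) : SimpleGraph {s : Finset (Fin n) // s.card = r} where
  Adj s t := s ≠ t ∧ Disjoint s.val t.val
  symm := ⟨fun _ _ h => ⟨h.1.symm, h.2.symm⟩⟩
  loopless := ⟨fun _ h => h.1 rfl⟩

/-! Colouring a set by its least element, truncated (`kneserGraph_colorable`), shows that a large
chromatic number forces `n - 2r` to be large. The rest uses only this.

Robust non-colourability: on a ground set of `2r + k + 1` points, every `k`-colouring of the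
`r`-sets gives one colour to two disjoint stable sets (`exists_disjoint_stable`). This follows from
Tucker's lemma, which is derived from a parity count of alternating chains (`sum_altWeight_chain`).
There are only polynomially many stable sets in `r`, for fixed `k`. Moving this small configuration
around by all permutations of the ground set, an averaging argument shows that every `k`-colouring
of `KG(n, r)` makes at least a fraction `1/q` of the edges monochromatic, with `q` polynomial in `r`
(`card_disjointPairs_le`).

Sparsification: edges are added one at a time to an empty graph on the same `N` vertices. As long as
degrees stay at most `Δ`, few edges of the host graph join vertices at distance at most `g` or meet
a saturated vertex, so some admissible edge is monochromatic in a fraction `1/(2q)` of the surviving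
proper `k`-colourings (`exists_sup_edge`). After `2qNk` such edges none of the `k ^ N` colourings
survives (`exists_sparse_subgraph`). The host degree `(n - r).choose r` must exceed a power of `r`
with exponent depending only on `k` and `g`; a large `n - 2r` ensures this
(`exists_sparsity_bound`). -/

/-! ### Parity of alternating sign sequences. -/

/-- The sign list alternates, starting with `b`. -/
def IsAltFrom : Bool → List Bool → Prop
  | _, [] => True
  | b, x :: l => x = b ∧ IsAltFrom (!b) l

open Classical in
/-- The indicator, modulo two, of alternation starting with `b`. -/
noncomputable def altInd (b : Bool) (l : List Bool) : ZMod 2 :=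
  if IsAltFrom b l then 1 else 0

@[simp] lemma altInd_nil (b : Bool) : altInd b [] = 1 := by simp [altInd, IsAltFrom]

lemma altInd_cons (b x : Bool) (l : List Bool) :
    altInd b (x :: l) = if x = b then altInd (!b) l else 0 := by
  unfold altInd
  split_ifs <;> simp_all [IsAltFrom]

lemma altInd_map_not (b : Bool) (l : List Bool) :
    altInd b (l.map (!·)) = altInd (!b) l := by
  induction l generalizing b with
  | nil => simp
  | cons x l ih =>
    rw [List.map_cons, altInd_cons, altInd_cons, ih]
    cases x <;> cases b <;> simp

/-- Deleting one entry from a sorted list: the number of deletions that leave an alternating list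
starting with `b` has the parity of the number of ways in which the list itself alternates. -/
lemma sum_altInd_erase {α : Type*} [LinearOrder α] (sgn : α → Bool) (b : Bool) (L : List α)
    (hL : L.Pairwise (· ≤ ·)) (hne : L ≠ []) :
    (L.map fun a => altInd b ((L.erase a).map sgn)).sum =
      altInd b (L.map sgn) + altInd (!b) (L.map sgn) := by
  induction L generalizing b with
  | nil => exact absurd rfl hne
  | cons x t ih =>
    -- `erase` removes the first copy. If `a = x`, sortedness makes `x` the head of `t` too, so both
    -- sides still agree.
    have key : ∀ a ∈ t, (x :: t).erase a = x :: t.erase a := by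
      intro a ha
      by_cases hax : x = a
      · subst hax
        rw [List.erase_cons_head]
        cases t with
        | nil => simp at ha
        | cons y t' =>
          have hy : x = y := by
            rw [List.pairwise_cons] at hL
            have h1 := hL.1 y (by simp)
            rcases List.mem_cons.1 ha with h | h
            · exact h
            · exact le_antisymm h1 ((List.pairwise_cons.1 hL.2).1 x h)
          subst hy
          rw [List.erase_cons_head]
      · rw [List.erase_cons_tail (by simpa using hax)]
    have hmap : (t.map fun a => altInd b (((x :: t).erase a).map sgn)) =
        t.map fun a => if sgn x = b then altInd (!b) ((t.erase a).map sgn) else 0 := by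
      refine List.map_congr_left fun a ha => ?_
      rw [key a ha, List.map_cons, altInd_cons]
    rw [List.map_cons, List.sum_cons, hmap, List.erase_cons_head, List.map_cons, altInd_cons,
      altInd_cons]
    by_cases ht : t = []
    · subst ht
      cases hx : sgn x <;> cases b <;> simp
    · have ih' := ih (!b) (List.pairwise_cons.1 hL).2 ht
      rw [Bool.not_not] at ih' ⊢
      -- If the head has sign `b`, deleting it contributes `altInd b` of the tail, which recurs in
      -- the induction hypothesis and cancels modulo two.
      by_cases hx : sgn x = b
      · have h2 : ∀ z : ZMod 2, z + z = 0 := by decide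
        simp only [hx, if_true, ih']
        rw [if_neg (by cases b <;> simp), add_comm (altInd (!b) _), ← add_assoc, h2]
        ring
      · have hx' : sgn x = !b := by
          revert hx; cases sgn x <;> cases b <;> simp
        simp [hx']

/-- The parity indicator that the sorted values of `f` alternate in sign, starting with `b`. -/
noncomputable def altWeight {α : Type*} [LinearOrder α] (sgn : α → Bool) {m : ℕ} (b : Bool)
    (f : Fin m → α) : ZMod 2 :=
  altInd b ((Multiset.sort (Finset.univ.val.map f)).map sgn)

/-- The link between a simplex and its facets: dropping a vertex erases one entry of the sorted list
of labels. -/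
lemma sum_altWeight_succAbove {α : Type*} [LinearOrder α] (sgn : α → Bool) {m : ℕ} (b : Bool)
    (f : Fin (m + 1) → α) :
    ∑ i : Fin (m + 1), altWeight sgn b (fun k => f (i.succAbove k)) =
      altWeight sgn b f + altWeight sgn (!b) f := by
  set M : Multiset α := Finset.univ.val.map f with hM
  have h1 : ∀ i : Fin (m + 1),
      (Finset.univ.val.map fun k => f (i.succAbove k)) = M.erase (f i) := by
    intro i
    have : M = f i ::ₘ (Finset.univ.val.map fun k => f (i.succAbove k)) := by
      rw [hM, Fin.univ_succAbove m i, Finset.cons_val, Multiset.map_cons, Finset.map_val,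
        Multiset.map_map]
      rfl
    rw [this, Multiset.erase_cons_head]
  have h2 : ∀ a, Multiset.sort (M.erase a) = (Multiset.sort M).erase a := by
    intro a
    refine List.Perm.eq_of_pairwise' (r := (· ≤ ·)) (Multiset.pairwise_sort _ _) ((Multiset.pairwise_sort M _).sublist
      List.erase_sublist) ?_
    rw [← Multiset.coe_eq_coe, Multiset.sort_eq, ← Multiset.coe_erase, Multiset.sort_eq]
  have h3 := sum_altInd_erase sgn b (Multiset.sort M) (Multiset.pairwise_sort M _) (by
    intro h
    have := congrArg List.length h
    simp [hM] at this)
  unfold altWeight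
  simp only [h1, h2]
  rw [← hM, ← h3, ← Multiset.sum_coe, ← Multiset.map_coe, Multiset.sort_eq, hM, Multiset.map_map]
  rfl

/-- The label with the same level and the opposite sign. -/
def flipLabel (a : ℕ ×ₗ Bool) : ℕ ×ₗ Bool := toLex ((ofLex a).1, !(ofLex a).2)

/-- The sign of a label. -/
def labelSign (a : ℕ ×ₗ Bool) : Bool := (ofLex a).2

/-- The level of a label. -/
def labelLevel (a : ℕ ×ₗ Bool) : ℕ := (ofLex a).1

lemma label_le_iff (a b : ℕ ×ₗ Bool) : a ≤ b ↔ labelLevel a < labelLevel b ∨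
    (labelLevel a = labelLevel b ∧ labelSign a ≤ labelSign b) := Prod.Lex.le_iff

lemma eq_flipLabel {a b : ℕ ×ₗ Bool} (h : labelLevel a = labelLevel b)
    (hs : labelSign a ≠ labelSign b) : a = flipLabel b := by
  obtain ⟨a1, a2⟩ := a
  obtain ⟨b1, b2⟩ := b
  have h' : a1 = b1 := h
  have hs' : a2 ≠ b2 := hs
  subst h'
  have : a2 = !b2 := by cases a2 <;> cases b2 <;> simp_all
  subst this
  rfl

/-- Flipping could reverse the order only inside a level, but without complementary values each
level carries a single sign. Hence flipping keeps the list sorted. -/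
lemma altWeight_flip {m : ℕ} (b : Bool) (f : Fin m → ℕ ×ₗ Bool)
    (hf : ∀ i j, f i ≠ flipLabel (f j)) :
    altWeight labelSign b (fun i => flipLabel (f i)) = altWeight labelSign (!b) f := by
  unfold altWeight
  set M : Multiset (ℕ ×ₗ Bool) := Finset.univ.val.map f with hM
  have hmem : ∀ a ∈ Multiset.sort M, ∃ i, f i = a := by
    intro a ha
    rw [Multiset.mem_sort, hM] at ha
    simpa using ha
  have h1 : Multiset.sort (Finset.univ.val.map fun i => flipLabel (f i)) =
      (Multiset.sort M).map flipLabel := by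
    refine List.Perm.eq_of_pairwise' (r := (· ≤ ·)) (Multiset.pairwise_sort _ _) ?_ ?_
    · rw [List.pairwise_map]
      refine (Multiset.pairwise_sort M (· ≤ ·)).imp_of_mem ?_
      intro x y hx hy hxy
      obtain ⟨i, rfl⟩ := hmem x hx
      obtain ⟨j, rfl⟩ := hmem y hy
      rw [label_le_iff] at hxy ⊢
      rcases hxy with h | ⟨h, -⟩
      · exact Or.inl h
      · refine Or.inr ⟨h, ?_⟩
        by_cases hs : labelSign (f i) = labelSign (f j)
        · have : labelSign (flipLabel (f i)) = labelSign (flipLabel (f j)) := by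
            change (!labelSign (f i)) = !labelSign (f j)
            rw [hs]
          exact this.le
        · exact absurd (eq_flipLabel h hs) (hf i j)
    · rw [← Multiset.coe_eq_coe, Multiset.sort_eq, ← Multiset.map_coe, Multiset.sort_eq, hM,
        Multiset.map_map]
      rfl
  rw [h1, ← altInd_map_not, List.map_map, List.map_map]
  rfl

/-- Neighbours in the sorted list have opposite signs, so equal levels would be complementary. The
`m` levels are therefore distinct. -/
lemma exists_level_of_altWeight {m : ℕ} (b : Bool) (f : Fin m → ℕ ×ₗ Bool)
    (hf : ∀ i j, f i ≠ flipLabel (f j)) (hw : altWeight labelSign b f ≠ 0) (N : ℕ)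
    (hN : ∀ i, labelLevel (f i) < N) : m ≤ N := by
  unfold altWeight at hw
  set M : Multiset (ℕ ×ₗ Bool) := Finset.univ.val.map f with hM
  have hmem : ∀ a ∈ Multiset.sort M, ∃ i, f i = a := by
    intro a ha
    rw [Multiset.mem_sort, hM] at ha
    simpa using ha
  have halt : IsAltFrom b ((Multiset.sort M).map labelSign) := by
    by_contra h
    exact hw (by simp [altInd, h])
  have hgen : ∀ (L : List (ℕ ×ₗ Bool)) (b : Bool), (∀ a ∈ L, ∃ i, f i = a) →
      L.Pairwise (· ≤ ·) → IsAltFrom b (L.map labelSign) →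
      (L.map labelLevel).IsChain (· < ·) := by
    intro L
    induction L with
    | nil => intros; simp
    | cons x t ih =>
      intro b hm hp ha
      cases t with
      | nil => simp
      | cons y t =>
        rw [List.map_cons, List.map_cons, List.isChain_cons_cons]
        refine ⟨?_, ih (!b) (fun a h => hm a (List.mem_cons_of_mem _ h))
          (List.pairwise_cons.1 hp).2 ha.2⟩
        have hxy := (List.pairwise_cons.1 hp).1 y (by simp)
        rcases (label_le_iff _ _).1 hxy with h | ⟨h, -⟩
        · exact h
        · exfalso
          obtain ⟨i, hi⟩ := hm x (by simp)
          obtain ⟨j, hj⟩ := hm y (by simp)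
          refine hf i j ?_
          rw [hi, hj]
          refine eq_flipLabel h ?_
          rw [ha.1, ha.2.1]
          simp
  have hc := hgen _ b hmem (Multiset.pairwise_sort M _) halt
  have hnd : ((Multiset.sort M).map labelLevel).Nodup :=
    (List.isChain_iff_pairwise.1 hc).imp fun h => h.ne
  have hlen : ((Multiset.sort M).map labelLevel).length = m := by simp [hM]
  rw [← hlen, ← List.toFinset_card_of_nodup hnd, ← Finset.card_range N]
  refine Finset.card_le_card fun l hl => ?_
  simp only [List.mem_toFinset, List.mem_map] at hl
  obtain ⟨a, ha, rfl⟩ := hl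
  obtain ⟨i, rfl⟩ := hmem a ha
  exact Finset.mem_range.2 (hN i)

/-! ### The lemmas of Ky Fan and Tucker. -/

/-- An antipodal labelling, without complementary edges, of the signed vectors over `Fin j`. Such
a vector is given by its support `S` and a sign function, of which only the values on `S` count. -/
structure IsTuckerLabelling {j : ℕ} (lam : Finset (Fin j) → (Fin j → Bool) → ℕ ×ₗ Bool) :
    Prop where
  congr : ∀ S s s', (∀ i ∈ S, s i = s' i) → lam S s = lam S s'
  antipodal : ∀ S s, S.Nonempty → lam S (fun i => !s i) = flipLabel (lam S s)
  not_compl : ∀ S T s, S.Nonempty → S ⊆ T → lam S s ≠ flipLabel (lam T s)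

lemma flipLabel_flipLabel (a : ℕ ×ₗ Bool) : flipLabel (flipLabel a) = a := by
  obtain ⟨a1, a2⟩ := a
  change toLex (a1, !!a2) = _
  rw [Bool.not_not]
  rfl

/-- The set of values of `π` at the places from `i` on. -/
def tailSet {j : ℕ} (π : Equiv.Perm (Fin j)) (i : Fin j) : Finset (Fin j) :=
  Finset.univ.filter fun e => i ≤ π.symm e

@[simp] lemma mem_tailSet {j : ℕ} {π : Equiv.Perm (Fin j)} {i e : Fin j} :
    e ∈ tailSet π i ↔ i ≤ π.symm e := by simp [tailSet]

lemma tailSet_nonempty {j : ℕ} (π : Equiv.Perm (Fin j)) (i : Fin j) : (tailSet π i).Nonempty :=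
  ⟨π i, by simp⟩

lemma tailSet_anti {j : ℕ} (π : Equiv.Perm (Fin j)) {i i' : Fin j} (h : i ≤ i') :
    tailSet π i' ⊆ tailSet π i := fun e he => by
  rw [mem_tailSet] at he ⊢
  exact h.trans he

lemma IsTuckerLabelling.chain_ne {j : ℕ} {lam : Finset (Fin j) → (Fin j → Bool) → ℕ ×ₗ Bool}
    (h : IsTuckerLabelling lam) (π : Equiv.Perm (Fin j)) (s : Fin j → Bool) (i i' : Fin j) :
    lam (tailSet π i) s ≠ flipLabel (lam (tailSet π i') s) := by
  rcases le_total i' i with hi | hi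
  · exact h.not_compl _ _ _ (tailSet_nonempty _ _) (tailSet_anti π hi)
  · intro he
    refine h.not_compl _ _ s (tailSet_nonempty _ i') (tailSet_anti π hi) ?_
    rw [he, flipLabel_flipLabel]

/-- A facet that omits an intermediate set of the chain lies in exactly two maximal chains, related
by this transposition. -/
lemma tailSet_mul_swap {j : ℕ} (π : Equiv.Perm (Fin (j + 1))) (i : Fin j) (k : Fin (j + 1))
    (hk : k ≠ i.succ) : tailSet (π * Equiv.swap i.castSucc i.succ) k = tailSet π k := by
  ext e
  rw [mem_tailSet, mem_tailSet]
  have : (π * Equiv.swap i.castSucc i.succ).symm e =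
      Equiv.swap i.castSucc i.succ (π.symm e) := rfl
  rw [this]
  generalize π.symm e = x
  have hk' : (k : ℕ) ≠ i + 1 := fun h => hk (Fin.ext (by simpa using h))
  rw [Equiv.swap_apply_def]
  split_ifs with h1 h2
  · subst h1
    simp only [Fin.le_def, Fin.val_succ, Fin.val_castSucc]
    omega
  · subst h2
    simp only [Fin.le_def, Fin.val_succ, Fin.val_castSucc]
    omega
  · rfl

/-- The equator, for the induction in Fan's lemma. The sign `true` at `0` is a dummy, as `0` is
outside the support. -/
lemma IsTuckerLabelling.restrict {j : ℕ}
    {lam : Finset (Fin (j + 1)) → (Fin (j + 1) → Bool) → ℕ ×ₗ Bool}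
    (h : IsTuckerLabelling lam) :
    IsTuckerLabelling fun (S : Finset (Fin j)) (t : Fin j → Bool) =>
      lam (S.map (Fin.succEmb j)) (Fin.cons true t) where
  congr S s s' hs := h.congr _ _ _ fun i hi => by
    obtain ⟨k, hk, rfl⟩ := Finset.mem_map.1 hi
    simpa using hs k hk
  antipodal S s hS := by
    rw [← h.antipodal _ _ (hS.map)]
    refine h.congr _ _ _ fun i hi => ?_
    obtain ⟨k, hk, rfl⟩ := Finset.mem_map.1 hi
    simp
  not_compl S T s hS hST := h.not_compl _ _ _ hS.map (Finset.map_subset_map.2 hST)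

lemma sum_fin_succ_bool {M : Type*} [AddCommMonoid M] {j : ℕ} (F : (Fin (j + 1) → Bool) → M) :
    ∑ s, F s = ∑ t : Fin j → Bool, (F (Fin.cons true t) + F (Fin.cons false t)) := by
  rw [← (Fin.consEquiv fun _ : Fin (j + 1) => Bool).sum_comp, Fintype.sum_prod_type,
    Fintype.sum_bool, ← Finset.sum_add_distrib]
  rfl

/-- **Ky Fan's lemma** for the barycentric subdivision of the cross-polytope: the number of
positive alternating chains is odd. -/
theorem sum_altWeight_chain (j : ℕ) (lam : Finset (Fin j) → (Fin j → Bool) → ℕ ×ₗ Bool)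
    (h : IsTuckerLabelling lam) :
    ∑ π : Equiv.Perm (Fin j), ∑ s : Fin j → Bool,
      altWeight labelSign true (fun i => lam (tailSet π i) s) = 1 := by
  induction j with
  | zero => simp [altWeight]
  | succ j ih =>
    have h2 : ∀ z : ZMod 2, z + z = 0 := by decide
    -- Antipodal chains are paired. The antipode of a chain is counted with alternation starting at
    -- `false`, so each pair contributes the boundary sum of the chain with sign `true` at `0`.
    have step1 : ∀ π : Equiv.Perm (Fin (j + 1)), ∑ s : Fin (j + 1) → Bool,
        altWeight labelSign true (fun i => lam (tailSet π i) s) =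
        ∑ t : Fin j → Bool, ∑ i : Fin (j + 1), altWeight labelSign true
          (fun k => lam (tailSet π (i.succAbove k)) (Fin.cons true t)) := by
      intro π
      rw [sum_fin_succ_bool, Finset.sum_add_distrib,
        ← (Equiv.piCongrRight fun _ : Fin j => Equiv.boolNot).sum_comp (fun t : Fin j → Bool =>
          altWeight labelSign true fun i => lam (tailSet π i) (Fin.cons false t)),
        ← Finset.sum_add_distrib]
      refine Finset.sum_congr rfl fun t _ => ?_
      rw [sum_altWeight_succAbove labelSign true
        (fun i => lam (tailSet π i) (Fin.cons true t)), ← altWeight_flip _ _ (h.chain_ne π _)]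
      congr 2
      funext i
      rw [← h.antipodal _ _ (tailSet_nonempty _ _)]
      congr 1
      funext k
      refine Fin.cases ?_ (fun k => ?_) k <;> simp
    rw [Finset.sum_congr rfl fun π _ => step1 π]
    have step2 : ∑ π : Equiv.Perm (Fin (j + 1)), ∑ t : Fin j → Bool, ∑ i : Fin (j + 1),
        altWeight labelSign true
          (fun k => lam (tailSet π (i.succAbove k)) (Fin.cons true t)) =
        ∑ π : Equiv.Perm (Fin (j + 1)), ∑ t : Fin j → Bool, altWeight labelSign true
          (fun k => lam (tailSet π k.succ) (Fin.cons true t)) := by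
      simp_rw [Fin.sum_univ_succ, Finset.sum_add_distrib]
      simp only [Fin.zero_succAbove, add_eq_left]
      rw [Finset.sum_comm]
      refine Finset.sum_eq_zero fun t _ => ?_
      rw [Finset.sum_comm]
      refine Finset.sum_eq_zero fun i _ => ?_
      refine Finset.sum_involution (fun π _ => π * Equiv.swap i.castSucc i.succ) ?_ ?_
        (fun _ _ => Finset.mem_univ _) ?_
      · intro π _
        simp only [tailSet_mul_swap π i _ (Fin.succAbove_ne _ _), h2]
      · intro π _ _ he
        rw [mul_eq_left, Equiv.swap_eq_one_iff] at he
        exact (Fin.castSucc_lt_succ (i := i)).ne he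
      · intro π _
        rw [mul_assoc, Equiv.swap_mul_self, mul_one]
    rw [step2, ← Equiv.Perm.decomposeFin.symm.sum_comp, Fintype.sum_prod_type,
      Fin.sum_univ_succ]
    -- The largest set left omits `p.succ`, so the sign there is irrelevant and flipping it pairs
    -- equal terms. Only permutations fixing `0` survive; they give the chains of the restricted
    -- labelling.
    have step3 : ∀ p : Fin j, ∑ e : Equiv.Perm (Fin j), ∑ t : Fin j → Bool,
        altWeight labelSign true (fun k =>
          lam (tailSet (Equiv.Perm.decomposeFin.symm (p.succ, e)) k.succ) (Fin.cons true t)) =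
        0 := by
      intro p
      refine Finset.sum_eq_zero fun e _ => ?_
      refine Finset.sum_involution (fun t _ => Function.update t p (!t p)) ?_ ?_
        (fun _ _ => Finset.mem_univ _) ?_
      · intro t _
        convert h2 _ using 3
        funext k
        refine h.congr _ _ _ fun i hi => ?_
        refine Fin.cases (by simp) (fun i hi => ?_) i hi
        simp only [Fin.cons_succ]
        rw [Function.update_of_ne]
        rintro rfl
        rw [mem_tailSet] at hi
        have : (Equiv.Perm.decomposeFin.symm (i.succ, e)).symm i.succ = 0 := by
          rw [Equiv.symm_apply_eq]; simp
        rw [this] at hi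
        exact absurd hi (by simp)
      · intro t _ _ he
        have := congrFun he p
        simp at this
      · intro t _
        simp
    rw [Finset.sum_eq_zero fun p _ => step3 p, add_zero, ← ih _ h.restrict]
    refine Finset.sum_congr rfl fun e _ => Finset.sum_congr rfl fun t _ => ?_
    congr 1
    funext k
    congr 1
    ext i
    rw [mem_tailSet]
    refine Fin.cases ?_ (fun i => ?_) i
    · have : (Equiv.Perm.decomposeFin.symm (0, e)).symm 0 = 0 := by
        rw [Equiv.symm_apply_eq]; simp
      simp [this]
    · have : (Equiv.Perm.decomposeFin.symm (0, e)).symm i.succ = (e.symm i).succ := by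
        rw [Equiv.symm_apply_eq]; simp
      rw [this]
      simp

/-- **Tucker's lemma** for the barycentric subdivision of the cross-polytope. -/
theorem IsTuckerLabelling.le_of_level_lt {j : ℕ}
    {lam : Finset (Fin j) → (Fin j → Bool) → ℕ ×ₗ Bool} (h : IsTuckerLabelling lam) (N : ℕ)
    (hN : ∀ S s, S.Nonempty → labelLevel (lam S s) < N) : j ≤ N := by
  have h1 := sum_altWeight_chain j lam h
  have : ∃ π s, altWeight labelSign true (fun i => lam (tailSet π i) s) ≠ 0 := by
    by_contra! hc
    simp [hc] at h1
  obtain ⟨π, s, hw⟩ := this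
  exact exists_level_of_altWeight true _ (h.chain_ne π s) hw N
    fun i => hN _ _ (tailSet_nonempty _ _)

/-! ### Alternating subsequences, stable sets and Schrijver's theorem. -/

/-- The greatest length of an alternating subsequence starting with `b`. -/
def altLen : Bool → List Bool → ℕ
  | _, [] => 0
  | b, x :: l => if x = b then altLen (!b) l + 1 else altLen b l

lemma altLen_map_not (b : Bool) (l : List Bool) :
    altLen b (l.map (!·)) = altLen (!b) l := by
  induction l generalizing b with
  | nil => rfl
  | cons x l ih =>
    simp only [List.map_cons, altLen, ih]
    cases x <;> cases b <;> simp

lemma altLen_le_succ (b : Bool) (l : List Bool) : altLen b l ≤ altLen (!b) l + 1 := by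
  induction l generalizing b with
  | nil => simp [altLen]
  | cons x l ih =>
    have h1 := ih b
    have h2 := ih (!b)
    simp only [altLen]
    cases x <;> cases b <;> simp_all <;> omega

lemma altLen_mono {l l' : List Bool} (h : l.Sublist l') (b : Bool) :
    altLen b l ≤ altLen b l' := by
  induction h generalizing b with
  | slnil => rfl
  | @cons l l' x _ ih =>
    have h1 := ih b
    have h2 := altLen_le_succ b l'
    simp only [altLen]
    split_ifs <;> omega
  | @cons_cons l l' x _ ih =>
    have h1 := ih b
    have h2 := ih (!b)
    simp only [altLen]
    split_ifs <;> omega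

/-- A longest alternating subsequence can only start with the first sign of the list, so it has a
well-defined initial sign. -/
lemma altLen_true_ne_false {l : List Bool} (h : l ≠ []) : altLen true l ≠ altLen false l := by
  cases l with
  | nil => exact absurd rfl h
  | cons x l => cases x <;> simp [altLen]

/-- The subsequence of `l` whose signs alternate, starting with `b`, chosen greedily. -/
def greedyAlt {α : Type*} (s : α → Bool) : Bool → List α → List α
  | _, [] => []
  | b, x :: l => if s x = b then x :: greedyAlt s (!b) l else greedyAlt s b l

lemma length_greedyAlt {α : Type*} (s : α → Bool) (b : Bool) (l : List α) :
    (greedyAlt s b l).length = altLen b (l.map s) := by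
  induction l generalizing b with
  | nil => rfl
  | cons x l ih =>
    simp only [greedyAlt, altLen, List.map_cons]
    split_ifs <;> simp [ih]

lemma greedyAlt_sublist {α : Type*} (s : α → Bool) (b : Bool) (l : List α) :
    (greedyAlt s b l).Sublist l := by
  induction l generalizing b with
  | nil => exact List.Sublist.refl _
  | cons x l ih =>
    simp only [greedyAlt]
    split_ifs
    · exact (ih _).cons_cons x
    · exact (ih _).cons x

lemma length_greedyAlt_le {α : Type*} (s : α → Bool) (b : Bool) (l : List α) :
    (greedyAlt s b l).length ≤ 2 * ((greedyAlt s b l).filter fun x => s x = b).length ∧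
    (greedyAlt s b l).length ≤ 2 * ((greedyAlt s b l).filter fun x => s x = !b).length + 1 := by
  induction l generalizing b with
  | nil => simp [greedyAlt]
  | cons x l ih =>
    simp only [greedyAlt]
    split_ifs with hx
    · have h1 := ih (!b)
      rw [Bool.not_not] at h1
      have hx' : s x ≠ !b := by rw [hx]; simp
      rw [List.filter_cons_of_pos (by simpa using hx), List.filter_cons_of_neg (by simpa using hx'),
        List.length_cons, List.length_cons]
      omega
    · exact ih b

lemma exists_lt_of_mem_greedyAlt {n : ℕ} (s : Fin n → Bool) (b : Bool) (l : List (Fin n))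
    (hl : l.Pairwise (· < ·)) (y : Fin n) (hy : y ∈ greedyAlt s (!b) l) (hs : s y = b) :
    ∃ z ∈ l, z < y := by
  cases l with
  | nil => simp [greedyAlt] at hy
  | cons z l =>
    refine ⟨z, by simp, (List.pairwise_cons.1 hl).1 y ?_⟩
    simp only [greedyAlt] at hy
    split_ifs at hy with hz
    · rcases List.mem_cons.1 hy with h | h
      · subst h
        rw [hs] at hz
        cases b <;> simp at hz
      · exact (greedyAlt_sublist _ _ _).subset h
    · exact (greedyAlt_sublist _ _ _).subset hy

/-- Between two chosen elements of the same sign the list has a further element. -/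
lemma greedyAlt_separated {n : ℕ} (s : Fin n → Bool) (b : Bool) (l : List (Fin n))
    (hl : l.Pairwise (· < ·)) (x y : Fin n) (hx : x ∈ greedyAlt s b l)
    (hy : y ∈ greedyAlt s b l) (hs : s x = s y) : (x : ℕ) + 1 ≠ y := by
  induction l generalizing b with
  | nil => simp [greedyAlt] at hx
  | cons z l ih =>
    rw [List.pairwise_cons] at hl
    simp only [greedyAlt] at hx hy
    split_ifs at hx hy with hz
    · rcases List.mem_cons.1 hx with hx' | hx' <;> rcases List.mem_cons.1 hy with hy' | hy'
      · subst hx' hy'; omega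
      · subst hx'
        obtain ⟨w, hw, hwy⟩ := exists_lt_of_mem_greedyAlt s b l hl.2 y hy' (hs ▸ hz)
        have := hl.1 w hw
        rw [Fin.lt_def] at this hwy
        omega
      · subst hy'
        have := hl.1 x ((greedyAlt_sublist _ _ _).subset hx')
        rw [Fin.lt_def] at this
        omega
      · exact ih _ hl.2 hx' hy'
    · exact ih _ hl.2 hx hy

/-- A set without two consecutive elements. -/
def IsStable {n : ℕ} (A : Finset (Fin n)) : Prop := ∀ x ∈ A, ∀ y ∈ A, (x : ℕ) + 1 ≠ y

/-- The increasing list of the elements of `S`. -/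
def incList {n : ℕ} (S : Finset (Fin n)) : List (Fin n) :=
  (List.finRange n).filter (· ∈ S)

lemma incList_pairwise {n : ℕ} (S : Finset (Fin n)) : (incList S).Pairwise (· < ·) :=
  (List.pairwise_lt_finRange n).filter _

@[simp] lemma mem_incList {n : ℕ} {S : Finset (Fin n)} {x : Fin n} : x ∈ incList S ↔ x ∈ S := by
  simp [incList]

lemma incList_sublist {n : ℕ} {S T : Finset (Fin n)} (h : S ⊆ T) :
    (incList S).Sublist (incList T) :=
  List.monotone_filter_right _ fun x hx => by
    simp only [decide_eq_true_eq] at hx ⊢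
    exact h hx

/-- An alternating sequence of length `2 * r` contains `r` terms of each sign, and terms of equal
sign are never consecutive. -/
lemma exists_isStable_of_le_altLen {n r : ℕ} (S : Finset (Fin n)) (s : Fin n → Bool) (b : Bool)
    (h : 2 * r ≤ altLen b ((incList S).map s)) (c : Bool) :
    ∃ A ⊆ S, A.card = r ∧ IsStable A ∧ ∀ x ∈ A, s x = c := by
  have h1 := length_greedyAlt_le s b (incList S)
  rw [length_greedyAlt] at h1
  set G := greedyAlt s b (incList S) with hG
  have hlen : r ≤ (G.filter fun x => s x = c).length := by
    by_cases hc : c = b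
    · subst hc; omega
    · have : c = !b := by cases c <;> cases b <;> simp_all
      subst this; omega
  have hnd : (G.filter fun x => s x = c).Nodup :=
    (((incList_pairwise S).sublist (greedyAlt_sublist _ _ _)).filter _).imp fun h => h.ne
  rw [← List.toFinset_card_of_nodup hnd] at hlen
  obtain ⟨A, hA, hcard⟩ := Finset.exists_subset_card_eq hlen
  have hmem : ∀ x ∈ A, x ∈ G ∧ s x = c := fun x hx => by simpa using hA hx
  refine ⟨A, fun x hx => ?_, hcard, fun x hx y hy => ?_, fun x hx => (hmem x hx).2⟩
  · exact mem_incList.1 ((greedyAlt_sublist _ _ _).subset (hmem x hx).1)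
  · exact greedyAlt_separated s b _ (incList_pairwise S) x y (hmem x hx).1 (hmem y hy).1
      ((hmem x hx).2.trans (hmem y hy).2.symm)

/-- The least colour of a stable `r`-set in the part of `S` with sign `b`. -/
noncomputable def minColour {n : ℕ} (r : ℕ) (c : Finset (Fin n) → ℕ) (S : Finset (Fin n))
    (s : Fin n → Bool) (b : Bool) : ℕ :=
  sInf {i | ∃ A ⊆ S, A.card = r ∧ IsStable A ∧ (∀ x ∈ A, s x = b) ∧ c A = i}

/-- The labelling that proves Schrijver's theorem. -/
noncomputable def schrijverLabel {n : ℕ} (r : ℕ) (c : Finset (Fin n) → ℕ) (S : Finset (Fin n))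
    (s : Fin n → Bool) : ℕ ×ₗ Bool :=
  let w := (incList S).map s
  if max (altLen true w) (altLen false w) < 2 * r then
    toLex (max (altLen true w) (altLen false w), decide (altLen false w < altLen true w))
  else
    toLex (2 * r + min (minColour r c S s true) (minColour r c S s false),
      decide (minColour r c S s true < minColour r c S s false))

/-- A weak form of Schrijver's theorem: in a `k`-colouring of the `r`-subsets of a set of
`2 * r + k + 1` elements, two disjoint stable sets have the same colour. -/
theorem exists_disjoint_stable {r k : ℕ} (c : Finset (Fin (2 * r + k + 1)) → ℕ)
    (hc : ∀ A, c A < k) :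
    ∃ A B : Finset (Fin (2 * r + k + 1)), A.card = r ∧ B.card = r ∧ IsStable A ∧ IsStable B ∧
      Disjoint A B ∧ c A = c B := by
  by_contra! hcon
  -- In the second branch of the label both signs carry a stable `r`-set, so `minColour` is attained
  -- and is not the default `0` of `sInf`.
  have hex : ∀ S s, ¬ max (altLen true ((incList S).map s)) (altLen false ((incList S).map s)) <
      2 * r → ∀ b, ∃ A ⊆ S, A.card = r ∧ IsStable A ∧ (∀ x ∈ A, s x = b) ∧
        c A = minColour r c S s b := by
    intro S s h b
    have : ∃ b, 2 * r ≤ altLen b ((incList S).map s) := by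
      rw [not_lt, le_max_iff] at h
      exact h.elim (fun h => ⟨true, h⟩) fun h => ⟨false, h⟩
    obtain ⟨b', hb'⟩ := this
    obtain ⟨A, h1, h2, h3, h4⟩ := exists_isStable_of_le_altLen S s b' hb' b
    exact Nat.sInf_mem (s := {i | ∃ A ⊆ S, A.card = r ∧ IsStable A ∧ (∀ x ∈ A, s x = b) ∧
      c A = i}) ⟨_, A, h1, h2, h3, h4, rfl⟩
  have hne : ∀ S T s, S ⊆ T →
      ¬ max (altLen true ((incList S).map s)) (altLen false ((incList S).map s)) < 2 * r →
      ¬ max (altLen true ((incList T).map s)) (altLen false ((incList T).map s)) < 2 * r → ∀ b,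
      minColour r c S s b ≠ minColour r c T s (!b) := by
    intro S T s _ hS hT b he
    obtain ⟨A, -, h2, h3, h4, h5⟩ := hex S s hS b
    obtain ⟨B, -, h2', h3', h4', h5'⟩ := hex T s hT (!b)
    refine hcon A B h2 h2' h3 h3' ?_ (by rw [h5, h5', he])
    refine Finset.disjoint_left.2 fun x hA hB => ?_
    have := (h4 x hA).symm.trans (h4' x hB)
    cases b <;> simp at this
  have hword : ∀ (S : Finset (Fin (2 * r + k + 1))) (s : Fin (2 * r + k + 1) → Bool),
      S.Nonempty → (incList S).map s ≠ [] := by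
    rintro S s ⟨x, hx⟩ h
    rw [List.map_eq_nil_iff] at h
    have := mem_incList.2 hx
    rw [h] at this
    simp at this
  have hT : IsTuckerLabelling (schrijverLabel (n := 2 * r + k + 1) r c) := by
    refine ⟨?_, ?_, ?_⟩
    · intro S s s' h
      have h1 : (incList S).map s = (incList S).map s' :=
        List.map_congr_left fun x hx => h x (mem_incList.1 hx)
      have h2 : ∀ b, minColour r c S s b = minColour r c S s' b := by
        intro b
        unfold minColour
        congr 1
        ext i
        refine exists_congr fun A => and_congr_right fun hA => ?_
        have : (∀ x ∈ A, s x = b) ↔ ∀ x ∈ A, s' x = b :=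
          forall₂_congr fun x hx => by rw [h x (hA hx)]
        rw [this]
      simp only [schrijverLabel, h1, h2]
    · intro S s hS
      have h1 : ∀ b, altLen b ((incList S).map fun i => !s i) =
          altLen (!b) ((incList S).map s) := by
        intro b
        rw [← altLen_map_not, List.map_map]
        rfl
      have h2 : ∀ b, minColour r c S (fun i => !s i) b = minColour r c S s (!b) := by
        intro b
        unfold minColour
        congr 1
        ext i
        refine exists_congr fun A => and_congr_right fun hA => ?_
        have : (∀ x ∈ A, (!s x) = b) ↔ ∀ x ∈ A, s x = !b :=
          forall₂_congr fun x hx => by cases s x <;> cases b <;> simp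
        rw [this]
      have h3 := altLen_true_ne_false (hword S s hS)
      have h4 := hne S S s le_rfl
      simp only [schrijverLabel, h1, h2, Bool.not_true, Bool.not_false]
      rw [max_comm (altLen false _), min_comm (minColour r c S s false)]
      split_ifs with hlt
      · change toLex _ = toLex (_, !decide _)
        rw [← decide_not]
        congr 3
        rw [eq_iff_iff]
        omega
      · have h5 := h4 hlt hlt true
        rw [Bool.not_true] at h5
        change toLex _ = toLex (_, !decide _)
        rw [← decide_not]
        congr 3
        rw [eq_iff_iff]
        omega
    · intro S T s hS hST he
      have m1 := altLen_mono ((incList_sublist hST).map s) true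
      have m2 := altLen_mono ((incList_sublist hST).map s) false
      have n1 := altLen_true_ne_false (hword S s hS)
      have n2 := altLen_true_ne_false (hword T s (hS.mono hST))
      have a1 := altLen_le_succ true ((incList S).map s)
      have a2 := altLen_le_succ false ((incList S).map s)
      have a3 := altLen_le_succ true ((incList T).map s)
      have a4 := altLen_le_succ false ((incList T).map s)
      simp only [Bool.not_true, Bool.not_false] at a1 a2 a3 a4
      have hl : labelLevel (schrijverLabel r c S s) = labelLevel (schrijverLabel r c T s) :=
        (congrArg labelLevel he).trans rfl
      have hs : labelSign (schrijverLabel r c S s) = !labelSign (schrijverLabel r c T s) :=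
        (congrArg labelSign he).trans rfl
      unfold schrijverLabel at hl hs
      by_cases h1 : max (altLen true ((incList S).map s)) (altLen false ((incList S).map s)) <
        2 * r <;>
      by_cases h2 : max (altLen true ((incList T).map s)) (altLen false ((incList T).map s)) <
        2 * r <;>
      simp only [h1, h2, if_true, if_false, labelLevel, labelSign, ofLex_toLex] at hl hs
      · rw [← decide_not, decide_eq_decide] at hs
        omega
      · omega
      · omega
      · rw [← decide_not, decide_eq_decide] at hs
        have e1 := hne S T s hST h1 h2 true
        have e2 := hne S T s hST h1 h2 false
        simp only [Bool.not_true, Bool.not_false] at e1 e2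
        omega
  -- Alternation lengths use levels below `2 * r` and colours the next `k`: one level fewer than the
  -- dimension, contradicting Tucker's lemma.
  have hle := hT.le_of_level_lt (2 * r + k) (by
    intro S s hS
    unfold schrijverLabel
    by_cases h1 : max (altLen true ((incList S).map s)) (altLen false ((incList S).map s)) <
        2 * r <;> simp only [h1, if_true, if_false, labelLevel, ofLex_toLex]
    · omega
    · obtain ⟨A, -, -, -, -, hA⟩ := hex S s h1 true
      have := hc A
      omega)
  omega

/-! ### Counting stable sets. -/

open Classical in
/-- The stable `r`-subsets of `Fin n`. -/
noncomputable def stableSets (n r : ℕ) : Finset (Finset (Fin n)) :=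
  Finset.univ.filter fun A => A.card = r ∧ IsStable A

/-- The elements that are neither in `A` nor successors of elements of `A`. -/
def freeSet {n : ℕ} (A : Finset (Fin n)) : Finset (Fin n) :=
  Finset.univ.filter fun e => e ∉ A ∧ ∀ x ∈ A, (x : ℕ) + 1 ≠ e

/-- `A`, its shift by one and the free set are disjoint; the shift may reach `n`, whence the bound
`n + 1`. -/
lemma card_freeSet_le {n : ℕ} {A : Finset (Fin n)} (hA : IsStable A) :
    (freeSet A).card + 2 * A.card ≤ n + 1 := by
  have h1 : ((freeSet A).map Fin.valEmbedding).card = (freeSet A).card := Finset.card_map _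
  have h2 : (A.map Fin.valEmbedding).card = A.card := Finset.card_map _
  have h3 : ((A.map Fin.valEmbedding).map (addRightEmbedding 1)).card = A.card := by
    rw [Finset.card_map, h2]
  have d1 : Disjoint (A.map Fin.valEmbedding)
      ((A.map Fin.valEmbedding).map (addRightEmbedding 1)) := by
    refine Finset.disjoint_left.2 fun x hx hx' => ?_
    simp only [Finset.mem_map, Fin.valEmbedding_apply, addRightEmbedding_apply,
      exists_exists_and_eq_and] at hx hx'
    obtain ⟨y, hy, rfl⟩ := hx
    obtain ⟨z, hz, hzy⟩ := hx'
    exact hA z hz y hy hzy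
  have d2 : Disjoint ((freeSet A).map Fin.valEmbedding) ((A.map Fin.valEmbedding) ∪
      ((A.map Fin.valEmbedding).map (addRightEmbedding 1))) := by
    refine Finset.disjoint_left.2 fun x hx hx' => ?_
    simp only [Finset.mem_union, Finset.mem_map, Fin.valEmbedding_apply, addRightEmbedding_apply,
      exists_exists_and_eq_and] at hx hx'
    obtain ⟨y, hy, rfl⟩ := hx
    simp only [freeSet, Finset.mem_filter, Finset.mem_univ, true_and] at hy
    rcases hx' with ⟨z, hz, hzy⟩ | ⟨z, hz, hzy⟩
    · exact hy.1 (Fin.ext hzy ▸ hz)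
    · exact hy.2 z hz hzy
  have hsub : ((freeSet A).map Fin.valEmbedding) ∪ ((A.map Fin.valEmbedding) ∪
      ((A.map Fin.valEmbedding).map (addRightEmbedding 1))) ⊆ Finset.range (n + 1) := by
    intro x hx
    simp only [Finset.mem_union, Finset.mem_map, Fin.valEmbedding_apply, addRightEmbedding_apply,
      exists_exists_and_eq_and] at hx
    rw [Finset.mem_range]
    rcases hx with ⟨z, -, rfl⟩ | ⟨z, -, rfl⟩ | ⟨z, -, rfl⟩ <;> omega
  have := Finset.card_le_card hsub
  rw [Finset.card_union_of_disjoint d2, Finset.card_union_of_disjoint d1, Finset.card_range] at this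
  omega

/-- A left-to-right scan recovers the set: a point belongs to it exactly when it is not free and its
predecessor is not in the set. -/
lemma IsStable.eq_of_freeSet_eq {n : ℕ} {A B : Finset (Fin n)} (hA : IsStable A)
    (hB : IsStable B) (h : freeSet A = freeSet B) : A = B := by
  have key : ∀ {C : Finset (Fin n)}, IsStable C → ∀ e, e ∈ C ↔ e ∉ freeSet C ∧
      ∀ x ∈ C, (x : ℕ) + 1 ≠ e := by
    intro C hC e
    simp only [freeSet, Finset.mem_filter, Finset.mem_univ, true_and, not_and]
    refine ⟨fun he => ⟨fun h => absurd he h, fun x hx => hC x hx e he⟩, fun ⟨h1, h2⟩ => ?_⟩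
    by_contra hn
    exact h1 hn h2
  have main : ∀ m : ℕ, ∀ e : Fin n, (e : ℕ) = m → (e ∈ A ↔ e ∈ B) := by
    intro m
    induction m using Nat.strong_induction_on with
    | _ m ih =>
      intro e he
      rw [key hA, key hB, h]
      refine and_congr_right fun _ => ⟨fun h x hx hxe => h x ?_ hxe, fun h x hx hxe => h x ?_ hxe⟩
      · exact (ih x (by omega) x rfl).2 hx
      · exact (ih x (by omega) x rfl).1 hx
  exact Finset.ext fun e => main e e rfl

lemma card_filter_card_le (n t : ℕ) :
    (Finset.univ.filter fun U : Finset (Fin n) => U.card ≤ t).card ≤ (n + 1) ^ t := by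
  induction t with
  | zero =>
    rw [pow_zero, Finset.card_le_one]
    intro a ha b hb
    simp only [Finset.mem_filter, Finset.mem_univ, true_and, Nat.le_zero,
      Finset.card_eq_zero] at ha hb
    rw [ha, hb]
  | succ t ih =>
    have h1 : (Finset.univ.filter fun U : Finset (Fin n) => U.card ≤ t + 1) ⊆
        (Finset.univ.filter fun U : Finset (Fin n) => U.card ≤ t) ∪
        Finset.powersetCard (t + 1) Finset.univ := by
      intro U hU
      simp only [Finset.mem_filter, Finset.mem_univ, true_and, Finset.mem_union,
        Finset.mem_powersetCard, Finset.subset_univ] at hU ⊢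
      omega
    have h2 := (Finset.card_le_card h1).trans (Finset.card_union_le _ _)
    rw [Finset.card_powersetCard, Finset.card_univ, Fintype.card_fin] at h2
    have h3 := Nat.choose_le_pow n (t + 1)
    have h4 : n ^ (t + 1) ≤ n * (n + 1) ^ t := by
      rw [pow_succ, mul_comm]
      exact Nat.mul_le_mul_left _ (Nat.pow_le_pow_left (by omega) _)
    calc _ ≤ (n + 1) ^ t + n * (n + 1) ^ t := by omega
      _ = (n + 1) ^ (t + 1) := by ring

lemma card_stableSets_le {n r t : ℕ} (hn : n = 2 * r + t) :
    (stableSets n r).card ≤ (n + 1) ^ (t + 1) := by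
  refine le_trans ?_ (card_filter_card_le n (t + 1))
  refine Finset.card_le_card_of_injOn freeSet ?_ ?_
  · intro A hA
    simp only [stableSets, Finset.coe_filter, Finset.mem_univ, true_and, Set.mem_ofPred_eq] at hA ⊢
    have := card_freeSet_le hA.2
    omega
  · intro A hA B hB h
    simp only [stableSets, Finset.coe_filter, Finset.mem_univ, true_and, Set.mem_ofPred_eq] at hA hB
    exact hA.2.eq_of_freeSet_eq hB.2 h

/-! ### Averaging over the symmetric group. -/

/-- Equidistribution of the orbit map of a transitive action. -/
lemma card_filter_act_mul_card {G X : Type*} [Group G] [Fintype G]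
    [DecidableEq X] (act : G → X → X)
    (hmul : ∀ σ τ x, act (σ * τ) x = act σ (act τ x)) (E M : Finset X) (hM : M ⊆ E) (f : X)
    (h1 : act 1 f = f) (hE : ∀ σ, act σ f ∈ E) (ht : ∀ x ∈ E, ∃ σ, act σ f = x) :
    (Finset.univ.filter fun σ => act σ f ∈ M).card * E.card = Fintype.card G * M.card := by
  set w := (Finset.univ.filter fun σ => act σ f = f).card with hw
  have hfib : ∀ x ∈ E, (Finset.univ.filter fun σ => act σ f = x).card = w := by
    intro x hx
    obtain ⟨τ, rfl⟩ := ht x hx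
    symm
    refine Finset.card_bij (fun σ _ => τ * σ) ?_ ?_ ?_
    · intro σ hσ
      simp only [Finset.mem_filter, Finset.mem_univ, true_and] at hσ ⊢
      rw [hmul, hσ]
    · intro σ _ σ' _ h
      exact mul_left_cancel h
    · intro σ hσ
      simp only [Finset.mem_filter, Finset.mem_univ, true_and] at hσ
      refine ⟨τ⁻¹ * σ, ?_, by group⟩
      simp only [Finset.mem_filter, Finset.mem_univ, true_and]
      rw [hmul, hσ, ← hmul, inv_mul_cancel, h1]
  have hcount : ∀ M' ⊆ E, (Finset.univ.filter fun σ => act σ f ∈ M').card = M'.card * w := by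
    intro M' hM'
    rw [Finset.card_eq_sum_card_fiberwise (f := fun σ => act σ f) (t := M')
      (fun σ hσ => by simpa using hσ)]
    rw [Finset.sum_const_nat (m := w)]
    intro x hx
    rw [← hfib x (hM' hx), Finset.filter_filter]
    congr 1
    ext σ
    simp only [Finset.mem_filter, Finset.mem_univ, true_and]
    exact ⟨fun h => h.2, fun h => ⟨h ▸ hx, h⟩⟩
  have hall := hcount E le_rfl
  rw [Finset.filter_true_of_mem (fun σ _ => hE σ), Finset.card_univ] at hall
  rw [hcount M hM, hall]
  ring

lemma exists_perm_map_eq {n r : ℕ} {A B A' B' : Finset (Fin n)} (hA : A.card = r)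
    (hB : B.card = r) (hA' : A'.card = r) (hB' : B'.card = r) (h : Disjoint A B)
    (h' : Disjoint A' B') :
    ∃ σ : Equiv.Perm (Fin n), A.map σ.toEmbedding = A' ∧ B.map σ.toEmbedding = B' := by
  let eA : A ≃ A' := Finset.equivOfCardEq (hA.trans hA'.symm)
  let eB : B ≃ B' := Finset.equivOfCardEq (hB.trans hB'.symm)
  let e : {x // x ∈ A ∪ B} ≃ {x // x ∈ A' ∪ B'} :=
    (Equiv.Finset.union A B h).symm.trans ((Equiv.sumCongr eA eB).trans
      (Equiv.Finset.union A' B' h'))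
  let σ : Equiv.Perm (Fin n) := e.extendSubtype
  have h1 : ∀ x (hx : x ∈ A), σ x = eA ⟨x, hx⟩ := by
    intro x hx
    have : x ∈ A ∪ B := Finset.mem_union_left _ hx
    simp only [σ]
    rw [Equiv.extendSubtype_apply_of_mem e x this]
    simp only [e, Equiv.trans_apply]
    rw [Equiv.Finset.union_symm_left h hx this]
    simp
  have h2 : ∀ x (hx : x ∈ B), σ x = eB ⟨x, hx⟩ := by
    intro x hx
    have : x ∈ A ∪ B := Finset.mem_union_right _ hx
    simp only [σ]
    rw [Equiv.extendSubtype_apply_of_mem e x this]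
    simp only [e, Equiv.trans_apply]
    rw [Equiv.Finset.union_symm_right h hx this]
    simp
  refine ⟨σ, ?_, ?_⟩
  · refine Finset.eq_of_subset_of_card_le ?_ (by rw [Finset.card_map, hA, hA'])
    intro y hy
    obtain ⟨x, hx, rfl⟩ := Finset.mem_map.1 hy
    change σ x ∈ A'
    rw [h1 x hx]
    exact (eA _).2
  · refine Finset.eq_of_subset_of_card_le ?_ (by rw [Finset.card_map, hB, hB'])
    intro y hy
    obtain ⟨x, hx, rfl⟩ := Finset.mem_map.1 hy
    change σ x ∈ B'
    rw [h2 x hx]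
    exact (eB _).2

/-- The ordered pairs of disjoint `r`-subsets of `Fin n`. -/
def disjointPairs (n r : ℕ) : Finset (Finset (Fin n) × Finset (Fin n)) :=
  Finset.univ.filter fun p => p.1.card = r ∧ p.2.card = r ∧ Disjoint p.1 p.2

/-- In every `k`-colouring of the `r`-subsets of a set with at least `2 * r + k + 1` elements,
a fraction of the disjoint pairs that is polynomial in `r⁻¹` is monochromatic. -/
theorem card_disjointPairs_le {n r k : ℕ} (hn : 2 * r + k + 1 ≤ n) (c : Finset (Fin n) → ℕ)
    (hc : ∀ A, c A < k) :
    (disjointPairs n r).card ≤ (2 * r + k + 2) ^ (2 * (k + 2)) *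
      ((disjointPairs n r).filter fun p => c p.1 = c p.2).card := by
  classical
  set E := disjointPairs n r with hE
  set M := E.filter fun p => c p.1 = c p.2 with hM
  let ι : Fin (2 * r + k + 1) ↪ Fin n := Fin.castLEEmb hn
  let act : Equiv.Perm (Fin n) → Finset (Fin n) × Finset (Fin n) →
    Finset (Fin n) × Finset (Fin n) :=
    fun σ p => (p.1.map σ.toEmbedding, p.2.map σ.toEmbedding)
  have hmul : ∀ σ τ x, act (σ * τ) x = act σ (act τ x) := by
    intro σ τ x
    simp only [act, Finset.map_map]
    rfl
  let F : Finset (Finset (Fin (2 * r + k + 1)) × Finset (Fin (2 * r + k + 1))) :=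
    (stableSets (2 * r + k + 1) r ×ˢ stableSets (2 * r + k + 1) r).filter
      fun p => Disjoint p.1 p.2
  let emb : Finset (Fin (2 * r + k + 1)) × Finset (Fin (2 * r + k + 1)) →
    Finset (Fin n) × Finset (Fin n) := fun p => (p.1.map ι, p.2.map ι)
  have hF : F.card ≤ (2 * r + k + 2) ^ (2 * (k + 2)) := by
    refine (Finset.card_filter_le _ _).trans ?_
    rw [Finset.card_product]
    have := card_stableSets_le (n := 2 * r + k + 1) (r := r) (t := k + 1) (by ring)
    calc _ ≤ (2 * r + k + 1 + 1) ^ (k + 1 + 1) * (2 * r + k + 1 + 1) ^ (k + 1 + 1) :=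
          Nat.mul_le_mul this this
      _ = _ := by rw [← pow_add]; congr 1; ring
  have hmemF : ∀ f ∈ F, (emb f).1.card = r ∧ (emb f).2.card = r ∧
      Disjoint (emb f).1 (emb f).2 := by
    intro f hf
    simp only [F, stableSets, Finset.mem_filter, Finset.mem_product, Finset.mem_univ,
      true_and] at hf
    simp only [emb, Finset.card_map, Finset.disjoint_map]
    exact ⟨hf.1.1.1, hf.1.2.1, hf.2⟩
  have hN : ∀ f ∈ F, (Finset.univ.filter fun σ => act σ (emb f) ∈ M).card * E.card =
      Fintype.card (Equiv.Perm (Fin n)) * M.card := by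
    intro f hf
    obtain ⟨h1, h2, h3⟩ := hmemF f hf
    refine card_filter_act_mul_card act hmul E M (Finset.filter_subset _ _) (emb f) ?_ ?_ ?_
    · simp only [act]
      exact Prod.ext (Finset.map_refl) (Finset.map_refl)
    · intro σ
      simp only [hE, disjointPairs, act, Finset.mem_filter, Finset.mem_univ, true_and,
        Finset.card_map, Finset.disjoint_map]
      exact ⟨h1, h2, h3⟩
    · intro x hx
      simp only [hE, disjointPairs, Finset.mem_filter, Finset.mem_univ, true_and] at hx
      obtain ⟨σ, e1, e2⟩ := exists_perm_map_eq h1 h2 hx.1 hx.2.1 h3 hx.2.2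
      exact ⟨σ, Prod.ext e1 e2⟩
  -- Each permutation carries the small configuration to a copy on which Schrijver's theorem yields
  -- a monochromatic pair from `F`. By equidistribution, a union bound over `F` then gives the
  -- fraction `1 / F.card`.
  have hcover : (Finset.univ : Finset (Equiv.Perm (Fin n))) ⊆
      F.biUnion fun f => Finset.univ.filter fun σ => act σ (emb f) ∈ M := by
    intro σ _
    obtain ⟨A, B, hA, hB, sA, sB, hd, hcc⟩ := exists_disjoint_stable (r := r) (k := k)
      (fun A => c ((A.map ι).map σ.toEmbedding)) (fun A => hc _)
    simp only [Finset.mem_biUnion, Finset.mem_filter, Finset.mem_univ, true_and]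
    refine ⟨(A, B), ?_, ?_⟩
    · simp only [F, stableSets, Finset.mem_filter, Finset.mem_product, Finset.mem_univ, true_and]
      exact ⟨⟨⟨hA, sA⟩, hB, sB⟩, hd⟩
    · simp only [hM, hE, disjointPairs, act, emb, Finset.mem_filter, Finset.mem_univ, true_and,
        Finset.card_map, Finset.disjoint_map]
      exact ⟨⟨hA, hB, hd⟩, hcc⟩
  have h1 := (Finset.card_le_card hcover).trans Finset.card_biUnion_le
  rw [Finset.card_univ] at h1
  have h2 := Nat.mul_le_mul_right E.card h1
  rw [Finset.sum_mul, Finset.sum_congr rfl hN, Finset.sum_const, smul_eq_mul,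
    mul_left_comm] at h2
  exact (Nat.le_of_mul_le_mul_left h2 Fintype.card_pos).trans (Nat.mul_le_mul_right _ hF)

/-! ### Sparse subgraphs that kill all colourings. -/

section Sparsification

open Classical

variable {V : Type*}

/-- A trail through a new edge splits there into two walks of the old graph. -/
lemma exists_split_of_mem_edges (H : SimpleGraph V) (u v : V) {x y : V}
    (p : (H ⊔ SimpleGraph.edge u v).Walk x y) (hp : p.edges.Nodup) (he : s(u, v) ∈ p.edges) :
    (∃ (a : H.Walk x u) (b : H.Walk v y), a.length + b.length + 1 = p.length) ∨
    (∃ (a : H.Walk x v) (b : H.Walk u y), a.length + b.length + 1 = p.length) := by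
  induction p with
  | nil => simp at he
  | @cons x x' y h p ih =>
    rw [SimpleGraph.Walk.edges_cons, List.nodup_cons] at hp
    by_cases hx : s(x, x') = s(u, v)
    · have ht : ∀ e ∈ p.edges, e ∈ H.edgeSet := by
        intro e hmem
        have h1 := p.edges_subset_edgeSet hmem
        induction e with
        | _ a b =>
          rw [SimpleGraph.mem_edgeSet, SimpleGraph.sup_adj] at h1
          rcases h1 with h1 | h1
          · exact h1
          · rw [SimpleGraph.edge_adj] at h1
            exfalso
            apply hp.1
            rw [hx]
            rcases h1.1 with ⟨rfl, rfl⟩ | ⟨rfl, rfl⟩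
            · exact hmem
            · rwa [Sym2.eq_swap]
      rcases Sym2.eq_iff.1 hx with ⟨rfl, rfl⟩ | ⟨rfl, rfl⟩
      · exact Or.inl ⟨SimpleGraph.Walk.nil, p.transfer H ht, by simp⟩
      · exact Or.inr ⟨SimpleGraph.Walk.nil, p.transfer H ht, by simp⟩
    · have hmem : s(u, v) ∈ p.edges := by
        rw [SimpleGraph.Walk.edges_cons, List.mem_cons] at he
        exact he.resolve_left fun h => hx h.symm
      have hadj : H.Adj x x' := by
        rcases h with h | h
        · exact h
        · rw [SimpleGraph.edge_adj] at h
          exfalso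
          apply hx
          rcases h.1 with ⟨rfl, rfl⟩ | ⟨rfl, rfl⟩
          · rfl
          · exact Sym2.eq_swap
      rcases ih hp.2 hmem with ⟨a, b, hab⟩ | ⟨a, b, hab⟩
      · refine Or.inl ⟨SimpleGraph.Walk.cons hadj a, b, ?_⟩
        simp only [SimpleGraph.Walk.length_cons]
        omega
      · refine Or.inr ⟨SimpleGraph.Walk.cons hadj a, b, ?_⟩
        simp only [SimpleGraph.Walk.length_cons]
        omega

/-- Joining two vertices at a distance greater than `g` creates no cycle of length at most `g`. -/
lemma lt_length_of_isCycle_sup_edge (H : SimpleGraph V) (u v : V) (g : ℕ)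
    (hH : ∀ x (w : H.Walk x x), w.IsCycle → g < w.length)
    (huv : ∀ w : H.Walk u v, g < w.length) (x : V) (w : (H ⊔ SimpleGraph.edge u v).Walk x x)
    (hw : w.IsCycle) : g < w.length := by
  by_cases he : s(u, v) ∈ w.edges
  -- Removing the new edge from the cycle leaves a walk in `H` between `u` and `v`, already longer
  -- than `g`.
  · rcases exists_split_of_mem_edges H u v w hw.edges_nodup he with ⟨a, b, hab⟩ | ⟨a, b, hab⟩
    · have := huv (b.append a).reverse
      rw [SimpleGraph.Walk.length_reverse, SimpleGraph.Walk.length_append] at this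
      omega
    · have := huv (b.append a)
      rw [SimpleGraph.Walk.length_append] at this
      omega
  · have ht : ∀ e ∈ w.edges, e ∈ H.edgeSet := by
      intro e hmem
      have h1 := w.edges_subset_edgeSet hmem
      induction e with
      | _ a b =>
        rw [SimpleGraph.mem_edgeSet, SimpleGraph.sup_adj] at h1
        rcases h1 with h1 | h1
        · exact h1
        · rw [SimpleGraph.edge_adj] at h1
          exfalso
          apply he
          rcases h1.1 with ⟨rfl, rfl⟩ | ⟨rfl, rfl⟩
          · exact hmem
          · rwa [Sym2.eq_swap]
    have := hH x (w.transfer H ht) (hw.transfer ht)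
    rwa [SimpleGraph.Walk.length_transfer] at this

variable [Fintype V]

/-- The neighbours of `v`, as a finset. -/
noncomputable def nbrs (H : SimpleGraph V) (v : V) : Finset V := Finset.univ.filter (H.Adj v)

@[simp] lemma mem_nbrs {H : SimpleGraph V} {v w : V} : w ∈ nbrs H v ↔ H.Adj v w := by
  simp [nbrs]

/-- The ordered pairs of adjacent vertices. -/
noncomputable def adjPairs (H : SimpleGraph V) : Finset (V × V) :=
  Finset.univ.filter fun p => H.Adj p.1 p.2

@[simp] lemma mem_adjPairs {H : SimpleGraph V} {p : V × V} :
    p ∈ adjPairs H ↔ H.Adj p.1 p.2 := by simp [adjPairs]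

lemma card_filter_fst_adjPairs (H : SimpleGraph V) (S : Finset V) :
    ((adjPairs H).filter fun p => p.1 ∈ S).card = ∑ v ∈ S, (nbrs H v).card := by
  rw [← Finset.card_sigma]
  refine Finset.card_bij (fun p _ => ⟨p.1, p.2⟩) ?_ ?_ ?_
  · intro p hp
    simp only [Finset.mem_filter, mem_adjPairs] at hp
    simpa using ⟨hp.2, hp.1⟩
  · rintro ⟨a, b⟩ _ ⟨a', b'⟩ _ h
    simpa using h
  · rintro ⟨a, b⟩ h
    refine ⟨(a, b), ?_, rfl⟩
    simp only [Finset.mem_sigma, mem_nbrs] at h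
    simpa using ⟨h.2, h.1⟩

lemma card_adjPairs (H : SimpleGraph V) : (adjPairs H).card = ∑ v, (nbrs H v).card := by
  rw [← card_filter_fst_adjPairs]
  simp

lemma card_filter_snd_adjPairs (H : SimpleGraph V) (S : Finset V) :
    ((adjPairs H).filter fun p => p.2 ∈ S).card = ∑ v ∈ S, (nbrs H v).card := by
  rw [← card_filter_fst_adjPairs]
  refine Finset.card_bij (fun p _ => p.swap) ?_ ?_ ?_
  · intro p hp
    simp only [Finset.mem_filter, mem_adjPairs] at hp
    simpa using ⟨hp.1.symm, hp.2⟩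
  · intro p _ p' _ h
    exact Prod.swap_injective h
  · intro p hp
    simp only [Finset.mem_filter, mem_adjPairs] at hp
    exact ⟨p.swap, by simpa using ⟨hp.1.symm, hp.2⟩, Prod.swap_swap p⟩

/-- The set of vertices within distance `i` of `u`. -/
noncomputable def ballSet (H : SimpleGraph V) : ℕ → V → Finset V
  | 0, u => {u}
  | i + 1, u => (insert u (nbrs H u)).biUnion (ballSet H i)

lemma card_ballSet_le (H : SimpleGraph V) (Δ : ℕ) (hΔ : ∀ v, (nbrs H v).card ≤ Δ) (i : ℕ)
    (u : V) : (ballSet H i u).card ≤ (Δ + 1) ^ i := by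
  induction i generalizing u with
  | zero => simp [ballSet]
  | succ i ih =>
    rw [ballSet, pow_succ']
    refine (Finset.card_biUnion_le_card_mul _ _ _ fun w _ => ih w).trans ?_
    exact Nat.mul_le_mul_right _ ((Finset.card_insert_le _ _).trans (Nat.succ_le_succ (hΔ u)))

lemma mem_ballSet_self (H : SimpleGraph V) (i : ℕ) (u : V) : u ∈ ballSet H i u := by
  induction i generalizing u with
  | zero => simp [ballSet]
  | succ i ih =>
    rw [ballSet, Finset.mem_biUnion]
    exact ⟨u, Finset.mem_insert_self _ _, ih u⟩

lemma mem_ballSet_of_walk (H : SimpleGraph V) {u v : V} (p : H.Walk u v) (i : ℕ)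
    (hp : p.length ≤ i) : v ∈ ballSet H i u := by
  induction p generalizing i with
  | nil => exact mem_ballSet_self H i _
  | cons h p ih =>
    cases i with
    | zero => simp at hp
    | succ i =>
      rw [SimpleGraph.Walk.length_cons] at hp
      rw [ballSet, Finset.mem_biUnion]
      exact ⟨_, Finset.mem_insert_of_mem (mem_nbrs.2 h), ih i (by omega)⟩

/-- The proper colourings of `H`. -/
noncomputable def properColourings (H : SimpleGraph V) (k : ℕ) : Finset (V → Fin k) :=
  Finset.univ.filter fun c => ∀ u v, H.Adj u v → c u ≠ c v

lemma nbrs_sup_edge_subset (H : SimpleGraph V) (u v w : V) (hw : w ≠ u) (hw' : w ≠ v) :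
    nbrs (H ⊔ SimpleGraph.edge u v) w ⊆ nbrs H w := by
  intro x hx
  rw [mem_nbrs, SimpleGraph.sup_adj, SimpleGraph.edge_adj] at hx
  rw [mem_nbrs]
  rcases hx with h | ⟨⟨h, -⟩ | ⟨h, -⟩, -⟩
  · exact h
  · exact absurd h.symm (by tauto)
  · exact absurd h.symm (by tauto)

lemma card_nbrs_sup_edge_le (H : SimpleGraph V) (u v w : V) :
    (nbrs (H ⊔ SimpleGraph.edge u v) w).card ≤ (nbrs H w).card + 1 := by
  have : nbrs (H ⊔ SimpleGraph.edge u v) w ⊆ insert (if w = u then v else u) (nbrs H w) := by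
    intro x hx
    rw [mem_nbrs, SimpleGraph.sup_adj, SimpleGraph.edge_adj] at hx
    rw [Finset.mem_insert, mem_nbrs]
    rcases hx with h | ⟨⟨h, h'⟩ | ⟨h, h'⟩, hne⟩
    · exact Or.inr h
    · subst h h'; simp
    · subst h h'
      left
      rw [if_neg hne]
  exact (Finset.card_le_card this).trans (Finset.card_insert_le _ _)

lemma card_adjPairs_sup_edge_le (H : SimpleGraph V) (u v : V) :
    (adjPairs (H ⊔ SimpleGraph.edge u v)).card ≤ (adjPairs H).card + 2 := by
  have : adjPairs (H ⊔ SimpleGraph.edge u v) ⊆ adjPairs H ∪ {(u, v), (v, u)} := by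
    rintro ⟨a, b⟩ hx
    rw [mem_adjPairs, SimpleGraph.sup_adj, SimpleGraph.edge_adj] at hx
    simp only [Finset.mem_union, mem_adjPairs, Finset.mem_insert, Finset.mem_singleton,
      Prod.mk.injEq]
    tauto
  exact (Finset.card_le_card this).trans ((Finset.card_union_le _ _).trans
    (Nat.add_le_add_left Finset.card_le_two _))

/-- One step of the sparsification: an edge can be added that destroys a given fraction of the
remaining proper colourings. -/
lemma exists_sup_edge (G H : SimpleGraph V) (D q k g Δ m : ℕ) (hHG : H ≤ G)
    (hV : 0 < Fintype.card V) (hD : 0 < D)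
    (hreg : ∀ v, (nbrs G v).card = D)
    (hmono : ∀ c : V → Fin k, Fintype.card V * D ≤
      q * ((adjPairs G).filter fun p => c p.1 = c p.2).card)
    (hpairs : (adjPairs H).card ≤ 2 * m) (hdeg : ∀ v, (nbrs H v).card ≤ Δ)
    (hH : ∀ x (w : H.Walk x x), w.IsCycle → g < w.length)
    (hΔ : 16 * q * m ≤ Fintype.card V * Δ) (hΔ0 : 0 < Δ) (hDΔ : 4 * q * (Δ + 1) ^ g ≤ D) :
    ∃ H' ≤ G, (adjPairs H').card ≤ (adjPairs H).card + 2 ∧ (∀ v, (nbrs H' v).card ≤ Δ) ∧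
      (∀ x (w : H'.Walk x x), w.IsCycle → g < w.length) ∧
      2 * q * (properColourings H' k).card + (properColourings H k).card ≤
        2 * q * (properColourings H k).card := by
  set N := Fintype.card V with hN
  set L := properColourings H k with hL
  by_cases hL0 : L.card = 0
  · exact ⟨H, hHG, by omega, hdeg, hH, by rw [← hL]; omega⟩
  set X : Finset V := Finset.univ.filter fun v => Δ ≤ (nbrs H v).card with hX
  have hXcard : X.card * Δ ≤ 2 * m := by
    refine le_trans ?_ hpairs
    rw [card_adjPairs]
    calc X.card * Δ = ∑ v ∈ X, Δ := by rw [Finset.sum_const, smul_eq_mul]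
      _ ≤ ∑ v ∈ X, (nbrs H v).card := Finset.sum_le_sum fun v hv => by simpa [hX] using hv
      _ ≤ ∑ v, (nbrs H v).card := Finset.sum_le_sum_of_subset (Finset.subset_univ _)
  have hX8 : 8 * q * X.card ≤ N := by
    refine Nat.le_of_mul_le_mul_right ?_ hΔ0
    calc 8 * q * X.card * Δ = 8 * q * (X.card * Δ) := by ring
      _ ≤ 8 * q * (2 * m) := Nat.mul_le_mul_left _ hXcard
      _ = 16 * q * m := by ring
      _ ≤ _ := hΔ
  have hsumX : ∑ v ∈ X, (nbrs G v).card = X.card * D := by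
    rw [Finset.sum_congr rfl fun v _ => hreg v, Finset.sum_const, smul_eq_mul]
  set bad1 := (adjPairs G).filter fun p => p.1 ∈ X
  set bad2 := (adjPairs G).filter fun p => p.2 ∈ X
  set bad3 := (adjPairs G).filter fun p => p.2 ∈ ballSet H g p.1
  have hb1 : bad1.card = X.card * D := (card_filter_fst_adjPairs G X).trans hsumX
  have hb2 : bad2.card = X.card * D := (card_filter_snd_adjPairs G X).trans hsumX
  have hb3 : bad3.card ≤ N * (Δ + 1) ^ g := by
    have : bad3.card ≤ (Finset.univ.sigma fun u : V => ballSet H g u).card := by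
      refine Finset.card_le_card_of_injOn (fun p => ⟨p.1, p.2⟩) ?_ ?_
      · intro p hp
        have hp' := (Finset.mem_filter.1 hp).2
        simpa using hp'
      · rintro ⟨a, b⟩ _ ⟨a', b'⟩ _ h
        simpa using h
    rw [Finset.card_sigma] at this
    refine this.trans ((Finset.sum_le_sum fun u _ => card_ballSet_le H Δ hdeg g u).trans ?_)
    rw [Finset.sum_const, smul_eq_mul, Finset.card_univ]
  -- At most `N / (8q)` vertices are saturated, so `bad1` and `bad2` cost at most `ND / (8q)` each
  -- and `bad3` at most `ND / (4q)`. Half of the `ND / q` monochromatic pairs remain usable.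
  have hbad : 2 * q * (bad1 ∪ (bad2 ∪ bad3)).card ≤ N * D := by
    have h1 := (Finset.card_union_le bad1 (bad2 ∪ bad3)).trans
      (Nat.add_le_add_left (Finset.card_union_le bad2 bad3) _)
    rw [hb1, hb2] at h1
    have h2 : 8 * q * X.card * D ≤ N * D := Nat.mul_le_mul_right _ hX8
    have h3 : N * (4 * q * (Δ + 1) ^ g) ≤ N * D := Nat.mul_le_mul_left _ hDΔ
    have h4 : 2 * q * (bad1 ∪ (bad2 ∪ bad3)).card ≤
        2 * q * (X.card * D + (X.card * D + N * (Δ + 1) ^ g)) :=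
      Nat.mul_le_mul_left _ (h1.trans (by omega))
    have e1 : 2 * (2 * q * (X.card * D + (X.card * D + N * (Δ + 1) ^ g))) =
        8 * q * X.card * D + N * (4 * q * (Δ + 1) ^ g) := by ring
    omega
  set A := adjPairs G \ (bad1 ∪ (bad2 ∪ bad3)) with hA
  have hAcard : A.card ≤ N * D := by
    refine (Finset.card_le_card Finset.sdiff_subset).trans ?_
    rw [card_adjPairs, Finset.sum_congr rfl fun v _ => hreg v, Finset.sum_const, smul_eq_mul,
      Finset.card_univ]
  have hgood : ∀ c ∈ L, N * D ≤ 2 * q * (A.filter fun p => c p.1 = c p.2).card := by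
    intro c _
    have h1 := hmono c
    have h2 : ((adjPairs G).filter fun p => c p.1 = c p.2) ⊆
        (A.filter fun p => c p.1 = c p.2) ∪ (bad1 ∪ (bad2 ∪ bad3)) := by
      intro p hp
      rw [Finset.mem_filter] at hp
      rw [Finset.mem_union, Finset.mem_filter, hA, Finset.mem_sdiff]
      tauto
    have h3 := (Finset.card_le_card h2).trans (Finset.card_union_le _ _)
    have h4 := Nat.mul_le_mul_left (2 * q) h3
    have e1 : 2 * q * ((adjPairs G).filter fun p => c p.1 = c p.2).card =
      2 * (q * ((adjPairs G).filter fun p => c p.1 = c p.2).card) := by ring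
    rw [mul_add] at h4
    omega
  have hdouble : ∑ c ∈ L, (A.filter fun p => c p.1 = c p.2).card =
      ∑ p ∈ A, (L.filter fun c => c p.1 = c p.2).card :=
    Finset.sum_card_bipartiteAbove_eq_sum_card_bipartiteBelow _
  have hNpos : 0 < N * D := Nat.mul_pos hV hD
  -- Pigeonhole: the pairs of `A` number at most `ND`, while each colouring makes at least `ND /
  -- (2q)` of them monochromatic.
  have hex : ∃ p ∈ A, L.card ≤ 2 * q * (L.filter fun c => c p.1 = c p.2).card := by
    by_contra! hcon
    have h1 : ∑ c ∈ L, N * D ≤ ∑ c ∈ L, 2 * q * (A.filter fun p => c p.1 = c p.2).card :=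
      Finset.sum_le_sum hgood
    rw [Finset.sum_const, smul_eq_mul, ← Finset.mul_sum, hdouble, Finset.mul_sum] at h1
    by_cases hAe : A.Nonempty
    · have h2 := Finset.sum_lt_sum_of_nonempty hAe hcon
      rw [Finset.sum_const, smul_eq_mul] at h2
      have h3 := Nat.mul_le_mul_right L.card hAcard
      rw [mul_comm (N * D)] at h3
      omega
    · rw [Finset.not_nonempty_iff_eq_empty] at hAe
      rw [hAe, Finset.sum_empty] at h1
      have := Nat.mul_pos (Nat.pos_of_ne_zero hL0) hNpos
      omega
  obtain ⟨⟨u, v⟩, hp, hkill⟩ := hex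
  rw [hA, Finset.mem_sdiff, Finset.mem_union, Finset.mem_union, mem_adjPairs] at hp
  obtain ⟨hGuv, hnb⟩ := hp
  simp only [bad1, bad2, bad3, Finset.mem_filter, mem_adjPairs, hGuv, true_and, not_or] at hnb
  obtain ⟨hu, hv, hball⟩ := hnb
  simp only [hX, Finset.mem_filter, Finset.mem_univ, true_and, not_le] at hu hv
  refine ⟨H ⊔ SimpleGraph.edge u v, ?_, card_adjPairs_sup_edge_le H u v, ?_, ?_, ?_⟩
  · refine sup_le hHG fun a b hab => ?_
    rw [SimpleGraph.edge_adj] at hab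
    rcases hab.1 with ⟨rfl, rfl⟩ | ⟨rfl, rfl⟩
    · exact hGuv
    · exact hGuv.symm
  · intro w
    by_cases h1 : w = u
    · subst h1
      exact (card_nbrs_sup_edge_le H w v w).trans hu
    by_cases h2 : w = v
    · subst h2
      exact (card_nbrs_sup_edge_le H u w w).trans hv
    exact (Finset.card_le_card (nbrs_sup_edge_subset H u v w h1 h2)).trans (hdeg w)
  · refine lt_length_of_isCycle_sup_edge H u v g hH fun w => ?_
    by_contra hw
    exact hball (mem_ballSet_of_walk H w g (by omega))
  · have hsub : properColourings (H ⊔ SimpleGraph.edge u v) k ⊆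
        L.filter fun c => ¬ c u = c v := by
      intro c hc
      simp only [properColourings, hL, Finset.mem_filter, Finset.mem_univ, true_and] at hc ⊢
      refine ⟨fun a b hab => hc a b (Or.inl hab), hc u v (Or.inr ?_)⟩
      rw [SimpleGraph.edge_adj]
      exact ⟨Or.inl ⟨rfl, rfl⟩, hGuv.ne⟩
    have h1 := Finset.card_le_card hsub
    have h2 := Finset.card_filter_add_card_filter_not (s := L) (fun c => c u = c v)
    have h3 := Nat.mul_le_mul_left (2 * q) h1
    have h4 : 2 * q * L.card = 2 * q * (L.filter fun c => c u = c v).card +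
        2 * q * (L.filter fun c => ¬ c u = c v).card := by rw [← h2, mul_add]
    change L.card ≤ 2 * q * (L.filter fun c => c u = c v).card at hkill
    omega

/-- Bernoulli's inequality for `(1 + 1/a) ^ (a + 1)`. With `a + 1 = 2 * q`, it says that `2 * q`
steps halve the number of colourings. -/
lemma two_mul_pow_le (a : ℕ) : 2 * a ^ (a + 1) ≤ (a + 1) ^ (a + 1) := by
  rcases Nat.eq_zero_or_pos a with rfl | ha
  · simp
  have key : ∀ n : ℕ, a ^ n * (a + n) ≤ (a + 1) ^ n * a := by
    intro n
    induction n with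
    | zero => simp
    | succ n ih =>
      calc a ^ (n + 1) * (a + (n + 1)) ≤ (a + 1) * (a ^ n * (a + n)) := by
            rw [pow_succ]
            have : a * (a + (n + 1)) ≤ (a + 1) * (a + n) := by nlinarith
            calc a ^ n * a * (a + (n + 1)) = a ^ n * (a * (a + (n + 1))) := by ring
              _ ≤ a ^ n * ((a + 1) * (a + n)) := Nat.mul_le_mul_left _ this
              _ = _ := by ring
        _ ≤ (a + 1) * ((a + 1) ^ n * a) := Nat.mul_le_mul_left _ ih
        _ = (a + 1) ^ (n + 1) * a := by ring
  refine Nat.le_of_mul_le_mul_right ((le_trans ?_ (key (a + 1)))) ha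
  calc 2 * a ^ (a + 1) * a = a ^ (a + 1) * (2 * a) := by ring
    _ ≤ _ := Nat.mul_le_mul_left _ (by omega)

/-- A regular graph of large degree, in every `k`-colouring of which a given fraction of the edges
is monochromatic, has a spanning subgraph of large girth that is not `k`-colourable. -/
theorem exists_sparse_subgraph (G : SimpleGraph V) (D q k g : ℕ) (hV : 0 < Fintype.card V)
    (hk : 0 < k) (hq : 0 < q) (hreg : ∀ v, (nbrs G v).card = D)
    (hmono : ∀ c : V → Fin k, Fintype.card V * D ≤
      q * ((adjPairs G).filter fun p => c p.1 = c p.2).card)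
    (hD : 4 * q * (32 * q ^ 2 * k + 1) ^ g ≤ D) :
    ∃ H ≤ G, (∀ x (w : H.Walk x x), w.IsCycle → g < w.length) ∧ ¬ H.Colorable k := by
  set N := Fintype.card V with hN
  -- The `m` steps below halve the count `N * k` times, enough because `k ^ N < 2 ^ (N * k)`; `Δ` is
  -- chosen so that `16 * q * m = N * Δ`.
  set Δ := 32 * q ^ 2 * k with hΔ
  set m := 2 * q * (N * k) with hm
  have hDpos : 0 < D := lt_of_lt_of_le (by positivity) hD
  have hΔpos : 0 < Δ := by positivity
  have iter : ∀ i ≤ m, ∃ H ≤ G, (adjPairs H).card ≤ 2 * i ∧ (∀ v, (nbrs H v).card ≤ Δ) ∧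
      (∀ x (w : H.Walk x x), w.IsCycle → g < w.length) ∧
      (2 * q) ^ i * (properColourings H k).card ≤ (2 * q - 1) ^ i * k ^ N := by
    intro i
    induction i with
    | zero =>
      intro _
      refine ⟨⊥, bot_le, ?_, ?_, ?_, ?_⟩
      · simp [adjPairs]
      · simp [nbrs]
      · intro x w hw
        exact absurd hw (SimpleGraph.isAcyclic_bot w)
      · rw [pow_zero, pow_zero, one_mul, one_mul]
        refine (Finset.card_le_univ _).trans ?_
        simp [hN]
    | succ i ih =>
      intro hi
      obtain ⟨H, hHG, h1, h2, h3, h4⟩ := ih (by omega)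
      obtain ⟨H', hHG', h1', h2', h3', h4'⟩ := exists_sup_edge G H D q k g Δ m hHG hV hDpos hreg
        hmono (by omega) h2 h3 (le_of_eq (by rw [hm, hΔ]; ring)) hΔpos hD
      refine ⟨H', hHG', by omega, h2', h3', ?_⟩
      have h5 : 2 * q * (properColourings H' k).card ≤
          (2 * q - 1) * (properColourings H k).card := by
        rw [Nat.sub_mul, one_mul]
        omega
      calc (2 * q) ^ (i + 1) * (properColourings H' k).card
          = (2 * q) ^ i * (2 * q * (properColourings H' k).card) := by ring
        _ ≤ (2 * q) ^ i * ((2 * q - 1) * (properColourings H k).card) :=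
          Nat.mul_le_mul_left _ h5
        _ = (2 * q - 1) * ((2 * q) ^ i * (properColourings H k).card) := by ring
        _ ≤ (2 * q - 1) * ((2 * q - 1) ^ i * k ^ N) := Nat.mul_le_mul_left _ h4
        _ = _ := by ring
  obtain ⟨H, hHG, -, -, h3, h4⟩ := iter m le_rfl
  refine ⟨H, hHG, h3, fun hcol => ?_⟩
  obtain ⟨c⟩ := hcol
  have hmem : (c : V → Fin k) ∈ properColourings H k := by
    simp only [properColourings, Finset.mem_filter, Finset.mem_univ, true_and]
    exact fun u v h => c.valid h
  have hpos := Finset.card_pos.2 ⟨_, hmem⟩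
  have h5 : (2 * q) ^ m ≤ (2 * q - 1) ^ m * k ^ N :=
    (Nat.le_mul_of_pos_right _ hpos).trans h4
  obtain ⟨a, ha⟩ : ∃ a, 2 * q = a + 1 := ⟨2 * q - 1, by omega⟩
  have ha0 : 0 < a := by omega
  rw [hm, ha, Nat.add_sub_cancel, pow_mul (a + 1) (a + 1) (N * k),
    pow_mul a (a + 1) (N * k)] at h5
  have h6 : (2 * a ^ (a + 1)) ^ (N * k) ≤ ((a + 1) ^ (a + 1)) ^ (N * k) :=
    Nat.pow_le_pow_left (two_mul_pow_le a) _
  rw [mul_pow] at h6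
  have h7 : k ^ N < 2 ^ (N * k) := by
    rw [mul_comm, pow_mul]
    exact Nat.pow_lt_pow_left Nat.lt_two_pow_self hV.ne'
  have h8 : 0 < (a ^ (a + 1)) ^ (N * k) := by positivity
  have h9 := Nat.mul_lt_mul_of_pos_right h7 h8
  rw [mul_comm _ (k ^ N)] at h5
  omega

end Sparsification

/-! ### Numerical bounds and Kneser graphs. -/

/-- For large `r`, the binomial coefficient with `d ≥ M + 1` is at least `r ^ (M + 1) / (M + 1)!`;
for `1 ≤ r ≤ R`, it is at least `d + 1`, and `d` is taken large enough. -/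
lemma exists_mul_pow_le_choose (K M : ℕ) :
    ∃ d : ℕ, ∀ r, 0 < r → K * r ^ M ≤ (r + d).choose r := by
  set R := K * (M + 1).factorial with hR
  refine ⟨max (M + 1) (K * R ^ M), fun r hr => ?_⟩
  rcases le_total R r with h | h
  · have h1 : (M + 1).factorial * (K * r ^ M) ≤ (M + 1).factorial * (r + (M + 1)).choose (M + 1) := by
      rw [← Nat.ascFactorial_eq_factorial_mul_choose]
      refine le_trans ?_ (Nat.pow_succ_le_ascFactorial (r + 1) (M + 1))
      calc (M + 1).factorial * (K * r ^ M) = R * r ^ M := by rw [hR]; ring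
        _ ≤ r * r ^ M := Nat.mul_le_mul_right _ h
        _ = r ^ (M + 1) := by ring
        _ ≤ (r + 1) ^ (M + 1) := Nat.pow_le_pow_left (by omega) _
    have h2 := Nat.le_of_mul_le_mul_left h1 (Nat.factorial_pos _)
    rw [← Nat.choose_symm_add] at h2
    exact h2.trans (Nat.choose_le_choose r (Nat.add_le_add_left (le_max_left _ _) _))
  · set d := max (M + 1) (K * R ^ M)
    calc K * r ^ M ≤ K * R ^ M := Nat.mul_le_mul_left _ (Nat.pow_le_pow_left h _)
      _ ≤ d := le_max_right _ _
      _ ≤ (d + 1).choose d := by simp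
      _ ≤ (r + d).choose d := Nat.choose_le_choose d (by omega)
      _ = (r + d).choose r := Nat.choose_symm_add.symm

lemma exists_sparsity_bound (k g : ℕ) :
    ∃ d : ℕ, ∀ r q, 0 < r → q = (2 * r + k + 2) ^ (2 * (k + 2)) →
      4 * q * (32 * q ^ 2 * k + 1) ^ g ≤ (r + d).choose r := by
  set e := 2 * (k + 2)
  obtain ⟨d, hd⟩ := exists_mul_pow_le_choose (4 * (32 * k + 1) ^ g * (k + 4) ^ (e * (1 + 2 * g)))
    (e * (1 + 2 * g))
  refine ⟨d, fun r q hr hq => le_trans ?_ (hd r hr)⟩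
  have hqpos : 0 < q := by rw [hq]; positivity
  have hq1 : q ≤ ((k + 4) * r) ^ e := by
    rw [hq]
    exact Nat.pow_le_pow_left (by nlinarith) _
  have h1 : 32 * q ^ 2 * k + 1 ≤ (32 * k + 1) * q ^ 2 := by
    have : 1 ≤ q ^ 2 := Nat.one_le_pow _ _ hqpos
    nlinarith
  calc 4 * q * (32 * q ^ 2 * k + 1) ^ g ≤ 4 * q * ((32 * k + 1) * q ^ 2) ^ g :=
        Nat.mul_le_mul_left _ (Nat.pow_le_pow_left h1 _)
    _ = 4 * (32 * k + 1) ^ g * q ^ (1 + 2 * g) := by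
        rw [mul_pow, ← pow_mul, pow_add, pow_one]; ring
    _ ≤ 4 * (32 * k + 1) ^ g * (((k + 4) * r) ^ e) ^ (1 + 2 * g) :=
        Nat.mul_le_mul_left _ (Nat.pow_le_pow_left hq1 _)
    _ = _ := by rw [← pow_mul, mul_pow]; ring

/-- The colour is the least element, capped at `d + 1`. The sets in the last class live on at most
`2 * r - 1` points, so any two of them meet. -/
lemma kneserGraph_colorable {n r d : ℕ} (hr : 0 < r) (hn : n ≤ 2 * r + d) :
    (kneserGraph n r).Colorable (d + 2) := by
  let m : {s : Finset (Fin n) // s.card = r} → ℕ := fun A =>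
    sInf {x : ℕ | ∃ a : Fin n, a ∈ A.1 ∧ (a : ℕ) = x}
  have hmem : ∀ A, ∃ a : Fin n, a ∈ A.1 ∧ (a : ℕ) = m A := by
    intro A
    obtain ⟨a, ha⟩ := Finset.card_pos.1 (A.2.symm ▸ hr : 0 < A.1.card)
    exact Nat.sInf_mem (s := {x : ℕ | ∃ a : Fin n, a ∈ A.1 ∧ (a : ℕ) = x}) ⟨a, a, ha, rfl⟩
  have hle : ∀ A, ∀ a : Fin n, a ∈ A.1 → m A ≤ a := fun A a ha => Nat.sInf_le ⟨a, ha, rfl⟩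
  refine ⟨SimpleGraph.Coloring.mk (fun A => (⟨min (m A) (d + 1), by omega⟩ : Fin (d + 2))) ?_⟩
  intro A B hAB he
  have hdis : Disjoint A.1 B.1 := hAB.2
  rw [Fin.mk.injEq] at he
  by_cases h : m A < d + 1
  · obtain ⟨a, ha, ha'⟩ := hmem A
    obtain ⟨b, hb, hb'⟩ := hmem B
    have : a = b := Fin.ext (by omega)
    exact Finset.disjoint_left.1 hdis ha (this ▸ hb)
  · have hsub : (A.1 ∪ B.1).map Fin.valEmbedding ⊆ Finset.Ico (d + 1) n := by
      intro x hx
      obtain ⟨a, ha, rfl⟩ := Finset.mem_map.1 hx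
      rw [Finset.mem_Ico]
      refine ⟨?_, a.2⟩
      change d + 1 ≤ (a : ℕ)
      rcases Finset.mem_union.1 ha with ha | ha
      · have := hle A a ha
        omega
      · have := hle B a ha
        omega
    have := Finset.card_le_card hsub
    rw [Finset.card_map, Finset.card_union_of_disjoint hdis, A.2, B.2, Nat.card_Ico] at this
    omega

lemma kneserGraph_adj_iff {n r : ℕ} (hr : 0 < r) (A B : {s : Finset (Fin n) // s.card = r}) :
    (kneserGraph n r).Adj A B ↔ Disjoint A.1 B.1 := by
  refine ⟨fun h => h.2, fun h => ⟨?_, h⟩⟩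
  rintro rfl
  rw [disjoint_self, Finset.bot_eq_empty] at h
  have := A.2
  rw [h, Finset.card_empty] at this
  omega

lemma card_nbrs_kneserGraph {n r : ℕ} (hr : 0 < r) (A : {s : Finset (Fin n) // s.card = r}) :
    (nbrs (kneserGraph n r) A).card = (n - r).choose r := by
  have h1 : (Finset.powersetCard r A.1ᶜ).card = (n - r).choose r := by
    rw [Finset.card_powersetCard, Finset.card_compl, A.2, Fintype.card_fin]
  rw [← h1]
  refine Finset.card_bij (fun B _ => B.1) ?_ (fun _ _ _ _ => Subtype.ext) ?_
  · intro B hB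
    rw [mem_nbrs, kneserGraph_adj_iff hr] at hB
    rw [Finset.mem_powersetCard]
    exact ⟨Finset.subset_compl_iff_disjoint_left.2 hB, B.2⟩
  · intro B hB
    rw [Finset.mem_powersetCard] at hB
    refine ⟨⟨B, hB.2⟩, ?_, rfl⟩
    rw [mem_nbrs, kneserGraph_adj_iff hr]
    exact Finset.subset_compl_iff_disjoint_left.1 hB.1

lemma card_adjPairs_kneserGraph_le {n r k : ℕ} (hr : 0 < r) (hk : 0 < k)
    (hn : 2 * r + k + 1 ≤ n) (c : {s : Finset (Fin n) // s.card = r} → Fin k) :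
    (adjPairs (kneserGraph n r)).card ≤ (2 * r + k + 2) ^ (2 * (k + 2)) *
      ((adjPairs (kneserGraph n r)).filter fun p => c p.1 = c p.2).card := by
  let c' : Finset (Fin n) → ℕ := fun A => if h : A.card = r then c ⟨A, h⟩ else 0
  have hc' : ∀ A, c' A < k := by
    intro A
    simp only [c']
    split_ifs
    · exact (c _).2
    · exact hk
  have hval : ∀ A : {s : Finset (Fin n) // s.card = r}, c' A.1 = c A := fun A => by
    simp [c', A.2]
  have h1 : (adjPairs (kneserGraph n r)).card ≤ (disjointPairs n r).card := by
    refine Finset.card_le_card_of_injOn (fun p => (p.1.1, p.2.1)) ?_ ?_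
    · intro p hp
      have hp' := (kneserGraph_adj_iff hr _ _).1 (mem_adjPairs.1 hp)
      simpa [disjointPairs] using ⟨p.1.2, p.2.2, hp'⟩
    · rintro ⟨a, b⟩ _ ⟨a', b'⟩ _ h
      simp only [Prod.mk.injEq] at h
      exact Prod.ext (Subtype.ext h.1) (Subtype.ext h.2)
  have h2 : ((disjointPairs n r).filter fun p => c' p.1 = c' p.2).card ≤
      ((adjPairs (kneserGraph n r)).filter fun p => c p.1 = c p.2).card := by
    refine Finset.card_le_card_of_surjOn (fun p => (p.1.1, p.2.1)) ?_
    rintro ⟨A, B⟩ hp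
    simp only [disjointPairs, Finset.coe_filter, Finset.mem_filter, Finset.mem_univ, true_and,
      Set.mem_ofPred_eq] at hp
    obtain ⟨⟨hA, hB, hd⟩, hcc⟩ := hp
    refine ⟨(⟨A, hA⟩, ⟨B, hB⟩), ?_, rfl⟩
    simp only [Finset.coe_filter, mem_adjPairs, Set.mem_ofPred_eq]
    refine ⟨(kneserGraph_adj_iff hr _ _).2 hd, Fin.ext ?_⟩
    rw [← hval, ← hval]
    exact hcc
  exact h1.trans ((card_disjointPairs_le hn c' hc').trans (Nat.mul_le_mul_left _ h2))

theorem mainTheorem4 (k g : ℕ) :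
    ∃ h : ℕ, ∀ n r : ℕ, (h : ℕ∞) ≤ (kneserGraph n r).chromaticNumber →
      ∃ H : (kneserGraph n r).Subgraph,
        (k : ℕ∞) ≤ H.coe.chromaticNumber ∧ (g : ℕ∞) < H.coe.egirth := by
  obtain ⟨d, hd⟩ := exists_sparsity_bound (k + 1) g
  -- `k + 2` leaves room for Schrijver's theorem with `k + 1` colours, which keeps the palette
  -- nonempty when `k = 0`; `d` supplies the degree; `+ 3` exceeds the `+ 2` of the explicit
  -- colouring.
  refine ⟨max d (k + 2) + 3, fun n r hχ => ?_⟩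
  have hnot : ∀ m, m < max d (k + 2) + 3 → ¬ (kneserGraph n r).Colorable m := by
    intro m hm hcol
    have := hχ.trans hcol.chromaticNumber_le
    rw [Nat.cast_le] at this
    omega
  have hr : 0 < r := by
    rcases Nat.eq_zero_or_pos r with rfl | h
    · refine absurd ?_ (hnot 1 (by omega))
      refine ⟨SimpleGraph.Coloring.mk (fun _ => 0) ?_⟩
      intro A B hAB _
      exact hAB.1 (Subtype.ext ((Finset.card_eq_zero.1 A.2).trans (Finset.card_eq_zero.1 B.2).symm))
    · exact h
  have hn : 2 * r + max d (k + 2) < n := by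
    by_contra h
    exact hnot _ (by omega) (kneserGraph_colorable hr (not_lt.1 h))
  set q := (2 * r + (k + 1) + 2) ^ (2 * ((k + 1) + 2)) with hq
  have hreg := card_nbrs_kneserGraph (n := n) hr
  have hcard : 0 < Fintype.card {s : Finset (Fin n) // s.card = r} := by
    rw [Fintype.card_finset_len, Fintype.card_fin]
    exact Nat.choose_pos (by omega)
  obtain ⟨H, hHG, hgirth, hcol⟩ := exists_sparse_subgraph (kneserGraph n r) ((n - r).choose r) q
    (k + 1) g hcard (Nat.succ_pos k) (by positivity) hreg (fun c => by
      have h1 := card_adjPairs_kneserGraph_le hr (Nat.succ_pos k) (by omega) c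
      rw [card_adjPairs, Finset.sum_congr rfl fun v _ => hreg v, Finset.sum_const, smul_eq_mul,
        Finset.card_univ] at h1
      exact h1)
    ((hd r q hr hq).trans (Nat.choose_le_choose r (by omega)))
  have hiso : H ≃g (SimpleGraph.toSubgraph H hHG).coe :=
    SimpleGraph.Subgraph.spanningCoeEquivCoeOfSpanning _ (SimpleGraph.toSubgraph.isSpanning H hHG)
  refine ⟨SimpleGraph.toSubgraph H hHG, ?_, ?_⟩
  · by_contra h
    refine hcol (SimpleGraph.Colorable.of_hom hiso.toHom
      (SimpleGraph.chromaticNumber_le_iff_colorable.1 ?_))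
    exact (not_le.1 h).le.trans (Nat.cast_le.2 (Nat.le_succ k))
  · rw [← hiso.egirth_eq]
    refine lt_of_lt_of_le (Nat.cast_lt.2 (Nat.lt_succ_self g)) (SimpleGraph.le_egirth.2 ?_)
    exact fun a w hw => Nat.cast_le.2 (hgirth a w hw)
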